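/- Let $a<b$, let $U,W\in C^3([a,b])$ be real-valued, let $\kappa\in\mathbb{R}$ (in the underlying problem $\kappa=k_3/k_1$ is the ratio of the wave numbers, $k_1\neq 0$), and put $H=U+\kappa W$. Suppose that $H'(y)\neq 0$ for all $y\in(a,b)$, and that $y_*\in(a,b)$ is an inflection point of $H$: $H''(y_*)=0$ and $H''$ changes sign at $y_*$ (it has one strict sign immediately to the left of $y_*$ and the opposite strict sign immediately to the right). Suppose also that the Sturm–Liouville operator $$Lv=-v''+\frac{H''}{H-H(y_*)}\,v$$ on $(a,b)$ with the Dirichlet boundary condition $v(a)=v(b)=0$ has a negative eigenvalue; here the potential is given at $y_*$ its limit value $H'''(y_*)/H'(y_*)$, so that it is continuous on $(a,b)$. For $\alpha>0$, call $c\in\mathbb{C}$ an unstable eigenvalue at $\alpha$ if $\operatorname{Im}c>0$ and the Rayleigh-type equation $$v''-\frac{H''}{H-c}\,v=\alpha^2v\ \text{ on }(a,b),\qquad v(a)=v(b)=0,$$ has a complex-valued solution $v\not\equiv0$, continuous on $[a,b]$ and twice differentiable on $(a,b)$. Then there is an unstable eigenvalue at some $\alpha>0$. In fact there is an unstable curve: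 there are $0\le\alpha_1<\alpha_2$ and a continuous function $c:(\alpha_1,\alpha_2)\to\mathbb{C}$ such that $c(\alpha)$ is an unstable eigenvalue at $\alpha$ for every $\alpha\in(\alpha_1,\alpha_2)$. -/

import Mathlib

open Set

/-- The function `f` changes sign at `x`: it has one strict sign immediately to the left of `x` and
the opposite strict sign immediately to the right of `x`. -/
def ChangesSignAt (f : ℝ → ℝ) (x : ℝ) : Prop :=
  ∃ δ > 0, ∀ y ∈ Ioo (x - δ) x, ∀ z ∈ Ioo x (x + δ), f y * f z < 0

/-- `v` is a nonzero function on `[a, b]`, continuous on `[a, b]`, twice differentiable in `(a, b)`,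
which satisfies the Dirichlet boundary condition `v(a) = v(b) = 0`. -/
structure IsNonzeroDirichlet {𝕜 : Type*} [RCLike 𝕜] (a b : ℝ) (v : ℝ → 𝕜) : Prop where
  continuousOn : ContinuousOn v (Icc a b)
  left : v a = 0
  right : v b = 0
  nonzero : ∃ y ∈ Ioo a b, v y ≠ 0
  differentiableAt : ∀ y ∈ Ioo a b, DifferentiableAt ℝ v y
  differentiableAt_deriv : ∀ y ∈ Ioo a b, DifferentiableAt ℝ (deriv v) y

/-- The potential `H'' / (H - H(y₀))`. At `y₀` itself, where the quotient is `0 / 0` when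
`H''(y₀) = 0`, it takes the limit value `H'''(y₀) / H'(y₀)`; see
`continuousAt_tollmienPotential`. -/
noncomputable def tollmienPotential (H : ℝ → ℝ) (y₀ y : ℝ) : ℝ :=
  if y = y₀ then deriv (deriv (deriv H)) y₀ / deriv H y₀
  else deriv (deriv H) y / (H y - H y₀)

/-- The value given to the potential at a zero `y₀` of `H''` is the one that makes it continuous
there. -/
theorem continuousAt_tollmienPotential {H : ℝ → ℝ} {y₀ : ℝ} (h1 : deriv H y₀ ≠ 0)
    (h2 : deriv (deriv H) y₀ = 0) (h3 : DifferentiableAt ℝ (deriv (deriv H)) y₀) :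
    ContinuousAt (tollmienPotential H y₀) y₀ := by
  have hH : HasDerivAt H (deriv H y₀) y₀ :=
    (differentiableAt_of_deriv_ne_zero h1).hasDerivAt
  have key := (hasDerivAt_iff_tendsto_slope.1 h3.hasDerivAt).div
    (hasDerivAt_iff_tendsto_slope.1 hH) h1
  rw [continuousAt_iff_punctured_nhds]
  have h0 : tollmienPotential H y₀ y₀ = deriv (deriv (deriv H)) y₀ / deriv H y₀ := by
    simp [tollmienPotential]
  rw [h0]
  refine key.congr' ?_
  filter_upwards [self_mem_nhdsWithin] with y hy
  have hy' : y ≠ y₀ := hy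
  have hs : y - y₀ ≠ 0 := sub_ne_zero.2 hy'
  simp only [tollmienPotential, if_neg hy', slope_def_field, Pi.div_apply, h2, sub_zero]
  exact div_div_div_cancel_right₀ hs _ _

/-- `lam` is an eigenvalue of the Sturm-Liouville operator `L v = -v'' + (H'' / (H - H(y₀))) v` on
`(a, b)` under the Dirichlet boundary condition. -/
def IsSturmLiouvilleEigenvalue (a b : ℝ) (H : ℝ → ℝ) (y₀ lam : ℝ) : Prop :=
  ∃ v : ℝ → ℝ, IsNonzeroDirichlet a b v ∧
    ∀ y ∈ Ioo a b, -deriv (deriv v) y + tollmienPotential H y₀ y * v y = lam * v y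

/-- `c` is an unstable eigenvalue, at the value `α` of the wave-number parameter, of the
Rayleigh-type equation `v'' - (H'' / (H - c)) v = α² v`, `v(a) = v(b) = 0`.
Instability means `Im σ > 0` for the mode `exp (i k₁ x + i k₃ z - i σ t)`; for `k₁ > 0` (that is,
`α = k₁ √(1 + κ²) > 0`) and `c = σ / k₁` this is `Im c > 0`. -/
def IsUnstableRayleighEigenvalue (a b : ℝ) (H : ℝ → ℝ) (α : ℝ) (c : ℂ) : Prop :=
  0 < c.im ∧ ∃ v : ℝ → ℂ, IsNonzeroDirichlet a b v ∧
    ∀ y ∈ Ioo a b,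
      deriv (deriv v) y - ((deriv (deriv H) y : ℝ) : ℂ) / ((H y : ℂ) - c) * v y = (α : ℂ) ^ 2 * v y

/-!
Write `X = C([a, b])`. The initial value problem `v'' = q v`, `v(a) = 0`, `v'(a) = 1` is the fixed
point equation `v = (y - a) + A v` in `X`, where `A = volterra q` is a Volterra operator with
`‖A‖ ≤ (b - a) ‖q‖_{L¹}`, and `μ` is a Dirichlet eigenvalue of `-d²/dy² + q` if and only if the
solution for `q - μ` vanishes at `b`. The negative eigenvalue assumed for the limiting potential
`K = H'' / (H - H(y*))` may be replaced by the lowest one, `μ₁ < 0`, whose eigenfunction `φ` is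
positive in `(a, b)` (`exists_lowest_eigenvalue`). It is a simple zero of the shooting function, so
the implicit function theorem, applied with the operator `A` itself as the parameter
(`exists_eigenvalue_branch`), continues it to an eigenvalue `μ(c)` of `-d²/dy² + H'' / (H - c)`,
holomorphic on the open set `S` of all `c` in the upper half-plane for which `H'' / (H - c)` is close
to `K` in `L¹`. The eigenfunction remains uniformly close to `φ`, hence bounded below near `y*`.

A number `c ∈ S` is an unstable eigenvalue at `α` as soon as `μ(c) = -α²`, so the point is to make
`μ(c)` real. The imaginary part of `μ(c)` has the sign of
`∫ H'' / |H - c|² |v|²` (`im_eigenvalue_mul_integral`), and for `c = H(y₀) + i s` with `s` small this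
integral is dominated by a neighbourhood of `y₀`, so that it has the sign of `H''(y₀)`
(`exists_mul_integral_im_pos`); the height `s = H''(y₀)⁴` is small enough. It is also large enough
for `c` to lie in `S`: the `L¹` distance to `K` exceeds an arbitrarily small constant by no more than
a multiple of `|H''(y₀)| arsinh (const / s)`, which is small even at this height
(`exists_integral_norm_sub_le`). Taking `y₀` on either side of `y*`, where `H''` has opposite signs,
and joining the two points by a path in `S` (`exists_isPreconnected_path`), one finds a point of the
path where `μ` is real. Since `μ` is holomorphic and not constant it is open, and its critical points
are isolated, so there is a nearby noncritical point where it is real; its local inverse there gives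
the curve `α ↦ c(α)` (`exists_continuousOn_eq_neg_sq`).

The height matters: `H''` may vanish to high order at `y*`, and then the points where `μ` is real
approach the real axis much faster than they approach `H(y*)`.
-/

/-! ### The Volterra operator of double integration -/

section Volterra

variable {𝕜 : Type*} [RCLike 𝕜] {a b : ℝ}

theorem hasDerivAt_integral_sub_smul {F : ℝ → 𝕜} (hF : Continuous F) (a y : ℝ) :
    HasDerivAt (fun y => ∫ s in a..y, (y - s) • F s) (∫ s in a..y, F s) y := by
  have hF' : Continuous fun s : ℝ => s • F s := continuous_id.smul hF
  have h1 : HasDerivAt (fun y => ∫ s in a..y, F s) (F y) y :=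
    intervalIntegral.integral_hasDerivAt_right (hF.intervalIntegrable _ _)
      hF.stronglyMeasurable.stronglyMeasurableAtFilter hF.continuousAt
  have h2 : HasDerivAt (fun y => ∫ s in a..y, s • F s) (y • F y) y :=
    intervalIntegral.integral_hasDerivAt_right (hF'.intervalIntegrable _ _)
      hF'.stronglyMeasurable.stronglyMeasurableAtFilter hF'.continuousAt
  have h3 := ((hasDerivAt_id y).smul h1).sub h2
  have hfun : (fun y => ∫ s in a..y, (y - s) • F s)
      = (fun y => id y • (∫ s in a..y, F s)) - fun y => ∫ s in a..y, s • F s := by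
    funext z
    simp only [sub_smul, Pi.sub_apply, id]
    rw [← intervalIntegral.integral_smul]
    exact intervalIntegral.integral_sub ((continuous_const.smul hF).intervalIntegrable _ _)
      (hF'.intervalIntegrable _ _)
  rw [hfun]
  exact h3.congr_deriv (by simp)

theorem continuous_extend_Icc (hab : a ≤ b) (f : C(Icc a b, 𝕜)) : Continuous (IccExtend hab f) :=
  f.continuous.Icc_extend'

theorem norm_extend_Icc_le (hab : a ≤ b) (f : C(Icc a b, 𝕜)) (s : ℝ) :
    ‖IccExtend hab f s‖ ≤ ‖f‖ :=
  f.norm_coe_le_norm _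

/-- A function `q v` is integrated twice, from `a`, at the cost of the `L¹` norm of `q`. -/
theorem norm_integral_sub_smul_mul_le (hab : a ≤ b) (q v : C(Icc a b, 𝕜)) (y : Icc a b) :
    ‖∫ s in a..y, ((y : ℝ) - s) • IccExtend hab (q * v) s‖
      ≤ (b - a) * (∫ s in a..b, ‖IccExtend hab q s‖) * ‖v‖ := by
  have hq := (continuous_extend_Icc hab q).norm
  have hy : (y : ℝ) ∈ Icc a b := y.2
  calc ‖∫ s in a..y, ((y : ℝ) - s) • IccExtend hab (q * v) s‖
      ≤ ∫ s in a..y, (b - a) * ‖IccExtend hab q s‖ * ‖v‖ := by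
        refine intervalIntegral.norm_integral_le_of_norm_le hy.1 (Filter.Eventually.of_forall ?_)
          (((continuous_const.mul hq).mul continuous_const).intervalIntegrable _ _)
        intro s hs
        have h1 : ‖(y : ℝ) - s‖ ≤ b - a := by
          rw [Real.norm_eq_abs, abs_le]; constructor <;> linarith [hs.1, hs.2, hy.2]
        have h2 : IccExtend hab (q * v) s = IccExtend hab q s * IccExtend hab v s := rfl
        rw [norm_smul, h2, norm_mul, ← mul_assoc]
        exact mul_le_mul (mul_le_mul_of_nonneg_right h1 (norm_nonneg _))
          (norm_extend_Icc_le hab v s) (norm_nonneg _)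
          (mul_nonneg (by linarith) (norm_nonneg _))
    _ ≤ ∫ s in a..b, (b - a) * ‖IccExtend hab q s‖ * ‖v‖ := by
        refine intervalIntegral.integral_mono_interval le_rfl hy.1 hy.2 ?_
          (((continuous_const.mul hq).mul continuous_const).intervalIntegrable _ _)
        refine Filter.Eventually.of_forall fun s => ?_
        have : 0 ≤ b - a := by linarith
        simp only [Pi.zero_apply]
        positivity
    _ = _ := by
        rw [intervalIntegral.integral_mul_const, intervalIntegral.integral_const_mul]

theorem norm_integral_sub_smul_le (hab : a ≤ b) (f : C(Icc a b, 𝕜)) (y : Icc a b) :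
    ‖∫ s in a..y, ((y : ℝ) - s) • IccExtend hab f s‖ ≤ (b - a) * (b - a) * ‖f‖ := by
  have h := norm_integral_sub_smul_mul_le hab 1 f y
  rw [one_mul] at h
  refine h.trans (le_of_eq ?_)
  have h1 : ∀ s, ‖IccExtend hab ⇑(1 : C(Icc a b, 𝕜)) s‖ = 1 := fun s => by
    simp [IccExtend]
  simp only [h1]
  simp

/-- The operator `f ↦ (y ↦ ∫ₐʸ (y - s) f(s) ds)` on continuous functions: the inverse of `d²/dy²`
under zero initial conditions at `a`. -/
noncomputable def doubleIntegral (𝕜 : Type*) [RCLike 𝕜] {a b : ℝ} (hab : a ≤ b) :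
    C(Icc a b, 𝕜) →L[𝕜] C(Icc a b, 𝕜) :=
  LinearMap.mkContinuous
    { toFun := fun f =>
        ⟨fun y => ∫ s in a..y, ((y : ℝ) - s) • IccExtend hab f s,
          (continuous_iff_continuousAt.2 fun y =>
            (hasDerivAt_integral_sub_smul (continuous_extend_Icc hab f) a y).continuousAt).comp
              continuous_subtype_val⟩
      map_add' := fun f g => by
        ext y
        have hf := continuous_extend_Icc hab f
        have hg := continuous_extend_Icc hab g
        have h2 : ∀ s, IccExtend hab (f + g) s = IccExtend hab f s + IccExtend hab g s :=
          fun s => rfl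
        simp only [ContinuousMap.coe_mk, ContinuousMap.add_apply, h2, smul_add]
        exact intervalIntegral.integral_add
          (((continuous_const.sub continuous_id).smul hf).intervalIntegrable _ _)
          (((continuous_const.sub continuous_id).smul hg).intervalIntegrable _ _)
      map_smul' := fun k f => by
        ext y
        have h2 : ∀ s, IccExtend hab (k • f) s = k • IccExtend hab f s := fun s => rfl
        simp only [ContinuousMap.coe_mk, ContinuousMap.smul_apply, h2, RingHom.id_apply]
        rw [← intervalIntegral.integral_smul]
        congr 1
        funext s
        rw [smul_comm] }
    ((b - a) * (b - a)) (fun f => by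
      refine (ContinuousMap.norm_le _ (by
        have : 0 ≤ b - a := by linarith
        positivity)).2 fun y => norm_integral_sub_smul_le hab f y)

theorem doubleIntegral_apply (hab : a ≤ b) (f : C(Icc a b, 𝕜)) (y : Icc a b) :
    doubleIntegral 𝕜 hab f y = ∫ s in a..y, ((y : ℝ) - s) • IccExtend hab f s := rfl

/-- The Volterra operator `v ↦ (y ↦ ∫ₐʸ (y - s) q(s) v(s) ds)` of the equation `v'' = q v`. -/
noncomputable def volterra {a b : ℝ} (hab : a ≤ b) (q : C(Icc a b, 𝕜)) :
    C(Icc a b, 𝕜) →L[𝕜] C(Icc a b, 𝕜) :=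
  (doubleIntegral 𝕜 hab).comp (ContinuousLinearMap.mul 𝕜 C(Icc a b, 𝕜) q)

theorem volterra_apply (hab : a ≤ b) (q v : C(Icc a b, 𝕜)) :
    volterra hab q v = doubleIntegral 𝕜 hab (q * v) := rfl

theorem volterra_sub (hab : a ≤ b) (p q : C(Icc a b, 𝕜)) :
    volterra hab (p - q) = volterra hab p - volterra hab q := by
  simp [volterra]

theorem volterra_sub_const (hab : a ≤ b) (q : C(Icc a b, 𝕜)) (μ : 𝕜) :
    volterra hab q - μ • doubleIntegral 𝕜 hab = volterra hab (q - algebraMap 𝕜 _ μ) := by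
  ext v y
  simp [volterra_apply, sub_mul, ← Algebra.smul_def, map_sub]

theorem norm_volterra_le (hab : a ≤ b) (q : C(Icc a b, 𝕜)) :
    ‖volterra hab q‖ ≤ (b - a) * ∫ s in a..b, ‖IccExtend hab q s‖ := by
  have h0 : 0 ≤ (b - a) * ∫ s in a..b, ‖IccExtend hab q s‖ :=
    mul_nonneg (by linarith) (intervalIntegral.integral_nonneg hab fun _ _ => norm_nonneg _)
  refine ContinuousLinearMap.opNorm_le_bound _ h0 fun v => ?_
  exact (ContinuousMap.norm_le _ (by positivity)).2 fun y =>
    norm_integral_sub_smul_mul_le hab q v y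

theorem norm_volterra_pow_apply_le (hab : a ≤ b) (q : C(Icc a b, 𝕜)) (n : ℕ)
    (v : C(Icc a b, 𝕜)) (y : Icc a b) :
    ‖(volterra hab q ^ n) v y‖
      ≤ ((b - a) * ‖q‖ * ((y : ℝ) - a)) ^ n / n.factorial * ‖v‖ := by
  induction n generalizing y with
  | zero => simpa using v.norm_coe_le_norm y
  | succ n ih =>
    have hy : (y : ℝ) ∈ Icc a b := y.2
    have hba : 0 ≤ b - a := by linarith
    set M := (b - a) * ‖q‖ with hM
    have hc : Continuous fun s : ℝ => M * ((M * (s - a)) ^ n / n.factorial * ‖v‖) := by fun_prop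
    rw [pow_succ', mul_apply_eq_comp, volterra_apply, doubleIntegral_apply]
    calc _ ≤ ∫ s in a..y, M * ((M * (s - a)) ^ n / n.factorial * ‖v‖) := by
          refine intervalIntegral.norm_integral_le_of_norm_le hy.1
            (Filter.Eventually.of_forall fun s hs => ?_) (hc.intervalIntegrable _ _)
          have hs' : s ∈ Icc a b := ⟨hs.1.le, hs.2.trans hy.2⟩
          have h1 : ‖(y : ℝ) - s‖ ≤ b - a := by
            rw [Real.norm_eq_abs, abs_le]; constructor <;> linarith [hs.1, hs.2, hy.2]
          have h2 : IccExtend hab (q * (volterra hab q ^ n) v) s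
              = q ⟨s, hs'⟩ * (volterra hab q ^ n) v ⟨s, hs'⟩ := by
            rw [IccExtend_of_mem _ _ hs']; rfl
          rw [norm_smul, h2, norm_mul, ← mul_assoc]
          exact mul_le_mul (mul_le_mul h1 (q.norm_coe_le_norm _) (norm_nonneg _) hba)
            (ih ⟨s, hs'⟩) (norm_nonneg _) (mul_nonneg hba (norm_nonneg _))
      _ = _ := by
          have h3 : ∀ s : ℝ, M * ((M * (s - a)) ^ n / n.factorial * ‖v‖)
              = M ^ (n + 1) / n.factorial * ‖v‖ * (s - a) ^ n := fun s => by
            rw [mul_pow]; ring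
          simp only [h3]
          rw [intervalIntegral.integral_const_mul,
            intervalIntegral.integral_comp_sub_right (fun s => s ^ n), integral_pow]
          have : ((n : ℝ) + 1) ≠ 0 := by positivity
          have hn : (n.factorial : ℝ) ≠ 0 := by positivity
          rw [Nat.factorial_succ]
          push_cast
          clear_value M
          rw [mul_pow]
          field_simp
          simp

theorem isUnit_one_sub_volterra (hab : a ≤ b) (q : C(Icc a b, 𝕜)) :
    IsUnit (1 - volterra hab q) := by
  have hba : 0 ≤ b - a := by linarith
  obtain ⟨n, hn⟩ := ((FloorSemiring.tendsto_pow_div_factorial_atTop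
    ((b - a) * ‖q‖ * (b - a))).eventually (gt_mem_nhds one_pos)).exists
  have h1 : ‖volterra hab q ^ n‖ < 1 := by
    refine lt_of_le_of_lt ?_ hn
    refine ContinuousLinearMap.opNorm_le_bound _ (by positivity) fun v => ?_
    refine (ContinuousMap.norm_le _ (by positivity)).2 fun y => ?_
    refine (norm_volterra_pow_apply_le hab q n v y).trans ?_
    have hy : (y : ℝ) ∈ Icc a b := y.2
    have hy0 : 0 ≤ (y : ℝ) - a := by linarith [hy.1]
    gcongr
    exact hy.2
  have h2 : IsUnit (1 - volterra hab q ^ n) :=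
    isUnit_one_sub_of_norm_lt_one (x := volterra hab q ^ n) h1
  have h3 : (1 - volterra hab q) * ∑ i ∈ Finset.range n, volterra hab q ^ i
      = 1 - volterra hab q ^ n := mul_neg_geom_sum (volterra hab q) n
  have h4 : (∑ i ∈ Finset.range n, volterra hab q ^ i) * (1 - volterra hab q)
      = 1 - volterra hab q ^ n := geom_sum_mul_neg (volterra hab q) n
  rw [← h3] at h2
  exact ((Commute.isUnit_mul_iff (h3.trans h4.symm)).1 h2).1

end Volterra

/-! ### Solutions of the initial value problem -/

section InitialValue

variable {𝕜 : Type*} [RCLike 𝕜] {a b : ℝ}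

/-- The function `y ↦ y - a`. -/
noncomputable def ramp (𝕜 : Type*) [RCLike 𝕜] (a b : ℝ) : C(Icc a b, 𝕜) :=
  ⟨fun y => (((y : ℝ) - a : ℝ) : 𝕜), by fun_prop⟩

/-- The solution `u` of `u = (y - a) + A u` (a junk value if `1 - A` is not invertible). For
`A = volterra hab q` it is the solution of `u'' = q u`, `u(a) = 0`, `u'(a) = 1`. -/
noncomputable def shoot (A : C(Icc a b, 𝕜) →L[𝕜] C(Icc a b, 𝕜)) : C(Icc a b, 𝕜) :=
  Ring.inverse (1 - A) (ramp 𝕜 a b)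

theorem inverse_one_sub_apply_eq {A : C(Icc a b, 𝕜) →L[𝕜] C(Icc a b, 𝕜)} (hA : IsUnit (1 - A))
    (f : C(Icc a b, 𝕜)) : Ring.inverse (1 - A) f = f + A (Ring.inverse (1 - A) f) := by
  have h1 : ((1 - A) * Ring.inverse (1 - A)) f = f := by
    rw [Ring.mul_inverse_cancel _ hA]; rfl
  have h2 : Ring.inverse (1 - A) f - A (Ring.inverse (1 - A) f) = f := h1
  exact sub_eq_iff_eq_add.1 h2

theorem eq_inverse_one_sub_apply {A : C(Icc a b, 𝕜) →L[𝕜] C(Icc a b, 𝕜)} (hA : IsUnit (1 - A))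
    {f u : C(Icc a b, 𝕜)} (hu : u = f + A u) : u = Ring.inverse (1 - A) f := by
  have h1 : (Ring.inverse (1 - A) * (1 - A)) u = u := by
    rw [Ring.inverse_mul_cancel _ hA]; rfl
  have h2 : (1 - A) u = f := sub_eq_iff_eq_add.2 hu
  rw [← h2]
  exact h1.symm

theorem shoot_volterra_eq (hab : a ≤ b) (q : C(Icc a b, 𝕜)) :
    shoot (volterra hab q) = ramp 𝕜 a b + doubleIntegral 𝕜 hab (q * shoot (volterra hab q)) :=
  inverse_one_sub_apply_eq (isUnit_one_sub_volterra hab q) _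

theorem contDiffAt_shoot {A : C(Icc a b, 𝕜) →L[𝕜] C(Icc a b, 𝕜)} (hA : IsUnit (1 - A)) :
    ContDiffAt 𝕜 1 (shoot : (C(Icc a b, 𝕜) →L[𝕜] C(Icc a b, 𝕜)) → C(Icc a b, 𝕜)) A := by
  obtain ⟨x, hx⟩ := hA
  have h1 : ContDiffAt 𝕜 1 Ring.inverse (1 - A) := by
    rw [← hx]
    exact contDiffAt_ringInverse 𝕜 (R := C(Icc a b, 𝕜) →L[𝕜] C(Icc a b, 𝕜)) (n := 1) x
  have h2 : ContDiffAt 𝕜 1 (fun A : C(Icc a b, 𝕜) →L[𝕜] C(Icc a b, 𝕜) => 1 - A) A :=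
    contDiffAt_const.sub contDiffAt_id
  exact (h1.comp A h2).clm_apply contDiffAt_const

theorem continuous_sub_smul {E : Type*} [NormedAddCommGroup E] [NormedSpace 𝕜 E]
    (A J : E →L[𝕜] E) : Continuous fun μ : 𝕜 => A - μ • J := by
  fun_prop

theorem continuous_shoot_volterra_sub_const (hab : a ≤ b) (q : C(Icc a b, 𝕜)) :
    Continuous fun μ : 𝕜 => shoot (volterra hab (q - algebraMap 𝕜 _ μ)) := by
  simp only [← volterra_sub_const]
  refine continuous_iff_continuousAt.2 fun μ => ?_
  have h1 := (contDiffAt_shoot (isUnit_one_sub_volterra hab (q - algebraMap 𝕜 _ μ))).continuousAt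
  rw [← volterra_sub_const] at h1
  exact ContinuousAt.comp (f := fun μ : 𝕜 => volterra hab q - μ • doubleIntegral 𝕜 hab) h1
    (continuous_sub_smul _ _).continuousAt

/-- The Volterra integral equation, read as an initial value problem. -/
theorem exists_hasDerivAt_of_eq_ramp_add (hab : a ≤ b) {u g : C(Icc a b, 𝕜)} {k : 𝕜}
    (hu : u = k • ramp 𝕜 a b + doubleIntegral 𝕜 hab g) :
    ∃ w w' : ℝ → 𝕜, (∀ y, HasDerivAt w (w' y) y) ∧ (∀ y, HasDerivAt w' (IccExtend hab g y) y) ∧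
      w a = 0 ∧ w' a = k ∧ ∀ y : Icc a b, w y = u y := by
  have hg := continuous_extend_Icc hab g
  refine ⟨fun y => k * ((y - a : ℝ) : 𝕜) + ∫ s in a..y, (y - s) • IccExtend hab g s,
    fun y => k + ∫ s in a..y, IccExtend hab g s, fun y => ?_, fun y => ?_, by simp, by simp,
    fun y => ?_⟩
  · have h1 : HasDerivAt (fun y : ℝ => ((y - a : ℝ) : 𝕜)) 1 y := by
      have := (RCLike.ofRealCLM (K := 𝕜)).hasFDerivAt.comp_hasDerivAt y
        ((hasDerivAt_id y).sub_const a)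
      simpa [Function.comp_def] using this
    exact ((h1.const_mul k).add (hasDerivAt_integral_sub_smul hg a y)).congr_deriv (by simp)
  · exact (intervalIntegral.integral_hasDerivAt_right (hg.intervalIntegrable _ _)
      hg.stronglyMeasurable.stronglyMeasurableAtFilter hg.continuousAt).const_add k
  · rw [hu]; rfl

theorem exists_hasDerivAt_shoot (hab : a ≤ b) (q : C(Icc a b, 𝕜)) :
    ∃ w w' : ℝ → 𝕜, (∀ y, HasDerivAt w (w' y) y) ∧
      (∀ y, HasDerivAt w' (IccExtend hab q y * IccExtend hab (shoot (volterra hab q)) y) y) ∧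
      w a = 0 ∧ w' a = 1 ∧ ∀ y : Icc a b, w y = shoot (volterra hab q) y :=
  exists_hasDerivAt_of_eq_ramp_add hab (g := q * shoot (volterra hab q))
    ((shoot_volterra_eq hab q).trans (by rw [one_smul]))

/-- Green's identity for two functions which vanish at both ends of the interval. -/
theorem integral_green_eq_zero {w₁ w₁' f₁ w₂ w₂' f₂ : ℝ → 𝕜}
    (h₁ : ∀ y, HasDerivAt w₁ (w₁' y) y) (h₁' : ∀ y, HasDerivAt w₁' (f₁ y) y)
    (h₂ : ∀ y, HasDerivAt w₂ (w₂' y) y) (h₂' : ∀ y, HasDerivAt w₂' (f₂ y) y)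
    (hf₁ : Continuous f₁) (hf₂ : Continuous f₂)
    (ha₁ : w₁ a = 0) (hb₁ : w₁ b = 0) (ha₂ : w₂ a = 0) (hb₂ : w₂ b = 0) :
    ∫ y in a..b, (f₁ y * w₂ y - w₁ y * f₂ y) = 0 := by
  have hc₁ : Continuous w₁ := continuous_iff_continuousAt.2 fun y => (h₁ y).continuousAt
  have hc₂ : Continuous w₂ := continuous_iff_continuousAt.2 fun y => (h₂ y).continuousAt
  have h : ∀ y, HasDerivAt (fun y => w₁' y * w₂ y - w₁ y * w₂' y)
      (f₁ y * w₂ y - w₁ y * f₂ y) y := fun y =>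
    (((h₁' y).mul (h₂ y)).sub ((h₁ y).mul (h₂' y))).congr_deriv (by ring)
  rw [intervalIntegral.integral_eq_sub_of_hasDerivAt (fun y _ => h y)
    (((hf₁.mul hc₂).sub (hc₁.mul hf₂)).intervalIntegrable _ _)]
  simp [*]

/-- The imaginary part of an eigenvalue of `-d²/dy² + q` is the average of that of `q`. -/
theorem im_eigenvalue_mul_integral (hab : a ≤ b) (q : C(Icc a b, ℂ)) (μ : ℂ)
    (hb : shoot (volterra hab (q - algebraMap ℂ _ μ)) ⟨b, hab, le_rfl⟩ = 0) :
    μ.im * (∫ y in a..b, ‖IccExtend hab (shoot (volterra hab (q - algebraMap ℂ _ μ))) y‖ ^ 2)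
      = ∫ y in a..b, (IccExtend hab q y).im *
          ‖IccExtend hab (shoot (volterra hab (q - algebraMap ℂ _ μ))) y‖ ^ 2 := by
  obtain ⟨w, w', h1, h2, h3, -, h5⟩ := exists_hasDerivAt_shoot hab (q - algebraMap ℂ _ μ)
  set u := shoot (volterra hab (q - algebraMap ℂ _ μ)) with hu
  have hwb : w b = 0 := by rw [← hb]; exact h5 ⟨b, hab, le_rfl⟩
  have hg := (continuous_extend_Icc hab (q - algebraMap ℂ _ μ)).mul (continuous_extend_Icc hab u)
  have key := integral_green_eq_zero h1 h2 (fun y => (h1 y).star) (fun y => (h2 y).star)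
    hg hg.star h3 hwb (by simp [h3]) (by simp [hwb])
  have hq := continuous_extend_Icc hab q
  have hn : Continuous fun y => ‖IccExtend hab u y‖ ^ 2 := (continuous_extend_Icc hab u).norm.pow 2
  have hi : Continuous fun y => (IccExtend hab q y).im * ‖IccExtend hab u y‖ ^ 2 :=
    (Complex.continuous_im.comp hq).mul hn
  have hj : Continuous fun y => μ.im * ‖IccExtend hab u y‖ ^ 2 := continuous_const.mul hn
  rw [← intervalIntegral.integral_const_mul, ← sub_eq_zero, ← intervalIntegral.integral_sub
    (hj.intervalIntegrable _ _) (hi.intervalIntegrable _ _)]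
  have h6 : ∀ y ∈ uIcc a b,
      IccExtend hab ⇑(q - algebraMap ℂ _ μ) y * IccExtend hab u y * star (w y)
        - w y * star (IccExtend hab ⇑(q - algebraMap ℂ _ μ) y * IccExtend hab u y)
      = (-2 * Complex.I) * ((μ.im * ‖IccExtend hab u y‖ ^ 2
          - (IccExtend hab q y).im * ‖IccExtend hab u y‖ ^ 2 : ℝ) : ℂ) := by
    intro y hy
    rw [uIcc_of_le hab] at hy
    have h7 : w y = IccExtend hab u y := by rw [IccExtend_of_mem _ _ hy]; exact h5 ⟨y, hy⟩
    have h8 : IccExtend hab ⇑(q - algebraMap ℂ _ μ) y = IccExtend hab q y - μ := by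
      simp [IccExtend]
    rw [h7, h8, ← Complex.normSq_eq_norm_sq]
    generalize IccExtend hab u y = z
    generalize IccExtend hab q y = r
    apply Complex.ext <;> simp [Complex.normSq_apply] <;> ring
  rw [intervalIntegral.integral_congr h6, intervalIntegral.integral_const_mul,
    intervalIntegral.integral_ofReal] at key
  have h9 := (mul_eq_zero.1 key).resolve_left (by simp [Complex.I_ne_zero])
  exact_mod_cast h9

/-- Solvability condition: if `φ'' = p φ` with zero boundary values, and the solution of
`ψ'' = p ψ + φ`, `ψ(a) = ψ'(a) = 0` vanishes at `b`, then `∫ φ² = 0`. Up to sign, `ψ(b)` is the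
derivative of the shooting function in the spectral parameter, so this makes real eigenvalues
simple zeros. -/
theorem integral_sq_eq_zero_of_inverse_apply (hab : a ≤ b) (p : C(Icc a b, 𝕜))
    (hb : shoot (volterra hab p) ⟨b, hab, le_rfl⟩ = 0)
    (hψ : Ring.inverse (1 - volterra hab p) (doubleIntegral 𝕜 hab (shoot (volterra hab p)))
      ⟨b, hab, le_rfl⟩ = 0) :
    ∫ y in a..b, (IccExtend hab (shoot (volterra hab p)) y) ^ 2 = 0 := by
  obtain ⟨w, w', h1, h2, h3, -, h5⟩ := exists_hasDerivAt_shoot hab p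
  set φ := shoot (volterra hab p) with hφ
  set ψ := Ring.inverse (1 - volterra hab p) (doubleIntegral 𝕜 hab φ) with hψdef
  have hψ' : ψ = (0 : 𝕜) • ramp 𝕜 a b + doubleIntegral 𝕜 hab (φ + p * ψ) := by
    rw [zero_smul, zero_add, map_add]
    exact inverse_one_sub_apply_eq (isUnit_one_sub_volterra hab p) _
  obtain ⟨z, z', k1, k2, k3, -, k5⟩ := exists_hasDerivAt_of_eq_ramp_add hab hψ'
  have key := integral_green_eq_zero k1 k2 h1 h2 (continuous_extend_Icc hab _)
    ((continuous_extend_Icc hab p).mul (continuous_extend_Icc hab φ)) k3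
    ((k5 ⟨b, hab, le_rfl⟩).trans hψ) h3
    ((h5 ⟨b, hab, le_rfl⟩).trans hb)
  rw [← key]
  refine intervalIntegral.integral_congr fun y hy => ?_
  rw [uIcc_of_le hab] at hy
  have e1 : w y = φ ⟨y, hy⟩ := h5 ⟨y, hy⟩
  have e2 : z y = ψ ⟨y, hy⟩ := k5 ⟨y, hy⟩
  simp only [IccExtend_of_mem _ _ hy, e1, e2, ContinuousMap.add_apply, ContinuousMap.mul_apply]
  ring

/-- For a real potential, the real and the complex solutions agree. -/
theorem shoot_volterra_ofReal (hab : a ≤ b) (p : C(Icc a b, ℝ)) (P : C(Icc a b, ℂ))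
    (hP : ∀ y, P y = p y) (y : Icc a b) :
    shoot (volterra hab P) y = shoot (volterra hab p) y := by
  let v : C(Icc a b, ℂ) := ⟨fun y => (shoot (volterra hab p) y : ℂ), by fun_prop⟩
  suffices h : v = shoot (volterra hab P) by rw [← h]; rfl
  refine eq_inverse_one_sub_apply (isUnit_one_sub_volterra hab P) ?_
  ext y
  have h1 := congrArg (fun f : C(Icc a b, ℝ) => ((f y : ℝ) : ℂ)) (shoot_volterra_eq hab p)
  refine h1.trans ?_
  simp only [ContinuousMap.add_apply, volterra_apply, doubleIntegral_apply, Complex.ofReal_add]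
  congr 1
  rw [← intervalIntegral.integral_ofReal]
  refine intervalIntegral.integral_congr fun s _ => ?_
  have h2 : IccExtend hab (P * v) s = IccExtend hab P s * IccExtend hab v s := rfl
  have h3 : IccExtend hab P s = (IccExtend hab p s : ℝ) := hP _
  have h4 : IccExtend hab v s = (IccExtend hab (shoot (volterra hab p)) s : ℝ) := rfl
  have h5 : IccExtend hab (p * shoot (volterra hab p)) s
    = IccExtend hab p s * IccExtend hab (shoot (volterra hab p)) s := rfl
  simp only [h2, h3, h4, h5, smul_eq_mul, Complex.ofReal_mul, Complex.real_smul]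

end InitialValue

/-! ### Perturbation of a simple eigenvalue -/

section Branch

open Filter Topology

variable {E : Type*} [NormedAddCommGroup E] [NormedSpace ℂ E] [CompleteSpace E]

theorem contDiffAt_inverse_one_sub_sub_smul (A₀ J : E →L[ℂ] E) (μ₀ : ℂ) (e : E)
    (hU : IsUnit (1 - (A₀ - μ₀ • J))) :
    ContDiffAt ℂ 1 (fun p : (E →L[ℂ] E) × ℂ => Ring.inverse (1 - (p.1 - p.2 • J)) e) (A₀, μ₀) := by
  obtain ⟨x, hx⟩ := hU
  have h1 : ContDiffAt ℂ 1 Ring.inverse (1 - (A₀ - μ₀ • J)) := by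
    rw [← hx]
    exact contDiffAt_ringInverse ℂ (R := E →L[ℂ] E) (n := 1) x
  have h2 : ContDiffAt ℂ 1 (fun p : (E →L[ℂ] E) × ℂ => 1 - (p.1 - p.2 • J)) (A₀, μ₀) :=
    contDiffAt_const.sub (contDiffAt_fst.sub (contDiffAt_snd.smul contDiffAt_const))
  exact (ContDiffAt.comp (A₀, μ₀) (g := Ring.inverse) h1 h2).clm_apply contDiffAt_const

theorem hasDerivAt_inverse_one_sub_sub_smul (A J : E →L[ℂ] E) (μ : ℂ) (e : E)
    (hU : IsUnit (1 - (A - μ • J))) :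
    HasDerivAt (fun μ : ℂ => Ring.inverse (1 - (A - μ • J)) e)
      (-Ring.inverse (1 - (A - μ • J)) (J (Ring.inverse (1 - (A - μ • J)) e))) μ := by
  obtain ⟨x, hx⟩ := hU
  have h2 : HasDerivAt (fun μ : ℂ => 1 - (A - μ • J)) J μ := by
    have := (((hasDerivAt_id μ).smul_const J).const_sub A).const_sub (1 : E →L[ℂ] E)
    simpa using this
  have h1 := hasFDerivAt_ringInverse (𝕜 := ℂ) (R := E →L[ℂ] E) x
  have hx' : (↑x⁻¹ : E →L[ℂ] E) = Ring.inverse (1 - (A - μ • J)) := by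
    rw [← hx, Ring.inverse_unit]
  rw [hx, hx'] at h1
  have h3 : HasDerivAt (fun μ : ℂ => Ring.inverse (1 - (A - μ • J)))
      (-(Ring.inverse (1 - (A - μ • J)) * J * Ring.inverse (1 - (A - μ • J)))) μ :=
    (HasFDerivAt.comp_hasDerivAt (f := fun μ : ℂ => 1 - (A - μ • J)) μ h1 h2).congr_deriv (by simp)
  exact (ContinuousLinearMap.apply ℂ E e).hasFDerivAt.comp_hasDerivAt μ h3

/-- A simple zero `μ₀` of `μ ↦ ℓ ((1 - A₀ + μ J)⁻¹ e)` continues to nearby operators `A`, as a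
differentiable function of `A`. -/
theorem exists_eigenvalue_branch (A₀ J : E →L[ℂ] E) (μ₀ : ℂ) (e : E) (ℓ : E →L[ℂ] ℂ)
    (hU : IsUnit (1 - (A₀ - μ₀ • J)))
    (h0 : ℓ (Ring.inverse (1 - (A₀ - μ₀ • J)) e) = 0)
    (h1 : ℓ (Ring.inverse (1 - (A₀ - μ₀ • J)) (J (Ring.inverse (1 - (A₀ - μ₀ • J)) e))) ≠ 0)
    {r : ℝ} (hr : 0 < r) :
    ∃ η > 0, ∃ ν : (E →L[ℂ] E) → ℂ, ∀ A, ‖A - A₀‖ < η →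
      DifferentiableAt ℂ ν A ∧ ‖ν A - μ₀‖ < r ∧
      ‖Ring.inverse (1 - (A - ν A • J)) e - Ring.inverse (1 - (A₀ - μ₀ • J)) e‖ < r ∧
      ℓ (Ring.inverse (1 - (A - ν A • J)) e) = 0 := by
  set G : (E →L[ℂ] E) × ℂ → E := fun p => Ring.inverse (1 - (p.1 - p.2 • J)) e with hG
  have cdG : ContDiffAt ℂ 1 G (A₀, μ₀) := contDiffAt_inverse_one_sub_sub_smul A₀ J μ₀ e hU
  have cdf : ContDiffAt ℂ 1 (fun p => ℓ (G p)) (A₀, μ₀) := ℓ.contDiff.contDiffAt.comp _ cdG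
  set L := fderiv ℂ (fun p => ℓ (G p)) (A₀, μ₀) ∘L .inr ℂ (E →L[ℂ] E) ℂ with hL
  have hL1 : L 1 ≠ 0 := by
    have e1 : HasDerivAt (fun μ : ℂ => ((A₀, μ) : (E →L[ℂ] E) × ℂ)) (0, 1) μ₀ :=
      (hasDerivAt_const μ₀ A₀).prodMk (hasDerivAt_id μ₀)
    have e2 := (cdf.differentiableAt one_ne_zero).hasFDerivAt.comp_hasDerivAt μ₀ e1
    have e3 := ℓ.hasFDerivAt.comp_hasDerivAt μ₀ (hasDerivAt_inverse_one_sub_sub_smul A₀ J μ₀ e hU)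
    have e4 := e2.unique e3
    intro hL0
    have e5 : L 1 = fderiv ℂ (fun p => ℓ (G p)) (A₀, μ₀) (0, 1) := by simp [hL]
    rw [e5, e4, map_neg, neg_eq_zero] at hL0
    exact h1 hL0
  have hLinv : L.IsInvertible := by
    refine ⟨ContinuousLinearEquiv.unitsEquivAut ℂ (Units.mk0 _ hL1), ?_⟩
    ext
    simp
  set ν := cdf.implicitFunction one_ne_zero hLinv with hν
  have hν0 : ν A₀ = μ₀ := cdf.implicitFunction_apply_self one_ne_zero hLinv
  have cdν : ContDiffAt ℂ 1 ν A₀ := cdf.contDiffAt_implicitFunction one_ne_zero hLinv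
  have ev1 : ∀ᶠ A in 𝓝 A₀, DifferentiableAt ℂ ν A :=
    (cdν.eventually (by simp)).mono fun A hA => hA.differentiableAt one_ne_zero
  have ev2 : ∀ᶠ A in 𝓝 A₀, ‖ν A - μ₀‖ < r := by
    have := cdν.continuousAt.eventually (Metric.ball_mem_nhds _ hr)
    rw [hν0] at this
    exact this.mono fun A hA => by rwa [← dist_eq_norm]
  have ev3 : ∀ᶠ A in 𝓝 A₀, ‖G (A, ν A) - G (A₀, μ₀)‖ < r := by
    have hc : ContinuousAt (fun A => G (A, ν A)) A₀ := by
      refine ContinuousAt.comp (g := G) (f := fun A => (A, ν A)) ?_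
        (continuousAt_id.prodMk cdν.continuousAt)
      rw [hν0]
      exact cdG.continuousAt
    have := hc.eventually (Metric.ball_mem_nhds _ hr)
    simp only [hν0] at this
    exact this.mono fun A hA => by rwa [← dist_eq_norm]
  have ev4 := cdf.eventually_apply_implicitFunction one_ne_zero hLinv
  obtain ⟨η, hη, hball⟩ := Metric.eventually_nhds_iff.1 (ev1.and (ev2.and (ev3.and ev4)))
  refine ⟨η, hη, ν, fun A hA => ?_⟩
  obtain ⟨a1, a2, a3, a4⟩ := hball (y := A) (by rwa [dist_eq_norm])
  exact ⟨a1, a2, a3, a4.trans h0⟩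

end Branch

/-! ### The lowest Dirichlet eigenvalue -/

section LowestEigenvalue

open Filter Topology

variable {a b : ℝ}

/-- For a nonnegative potential the solution of the initial value problem does not return to zero:
`u u'` is increasing. -/
theorem shoot_volterra_ne_zero_of_nonneg (hab : a ≤ b) (p : C(Icc a b, ℝ)) (hp : ∀ y, 0 ≤ p y)
    (y : Icc a b) (hy : a < y) : shoot (volterra hab p) y ≠ 0 := by
  intro h0
  obtain ⟨w, w', h1, h2, h3, h4, h5⟩ := exists_hasDerivAt_shoot hab p
  set u := shoot (volterra hab p)
  have hd : ∀ x, HasDerivAt (fun x => w x * w' x)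
      (w' x * w' x + w x * (IccExtend hab p x * IccExtend hab u x)) x :=
    fun x => (h1 x).mul (h2 x)
  have hmono : MonotoneOn (fun x => w x * w' x) (Icc a b) := by
    refine monotoneOn_of_deriv_nonneg (convex_Icc a b)
      (fun x _ => (hd x).continuousAt.continuousWithinAt)
      (fun x _ => (hd x).differentiableAt.differentiableWithinAt) fun x hx => ?_
    rw [interior_Icc] at hx
    have hx' := Ioo_subset_Icc_self hx
    rw [(hd x).deriv, IccExtend_of_mem _ _ hx', IccExtend_of_mem _ _ hx', ← h5 ⟨x, hx'⟩]
    nlinarith [hp ⟨x, hx'⟩, mul_self_nonneg (w x), mul_self_nonneg (w' x),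
      mul_nonneg (hp ⟨x, hx'⟩) (mul_self_nonneg (w x))]
  have hd2 : ∀ x, HasDerivAt (fun x => w x * w x) (w' x * w x + w x * w' x) x :=
    fun x => (h1 x).mul (h1 x)
  have hmono2 : MonotoneOn (fun x => w x * w x) (Icc a b) := by
    refine monotoneOn_of_deriv_nonneg (convex_Icc a b)
      (fun x _ => (hd2 x).continuousAt.continuousWithinAt)
      (fun x _ => (hd2 x).differentiableAt.differentiableWithinAt) fun x hx => ?_
    rw [interior_Icc] at hx
    have hx' := Ioo_subset_Icc_self hx
    have := hmono ⟨le_rfl, hab⟩ hx' hx'.1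
    simp only [h3, zero_mul] at this
    rw [(hd2 x).deriv]
    linarith
  have hwy : w y = 0 := (h5 y).trans h0
  have hzero : ∀ x ∈ Icc a (y : ℝ), w x = 0 := by
    intro x hx
    have := hmono2 ⟨hx.1, hx.2.trans y.2.2⟩ y.2 hx.2
    simp only [hwy, zero_mul] at this
    exact mul_self_eq_zero.1 (le_antisymm this (mul_self_nonneg _))
  have hder : HasDerivWithinAt w 0 (Icc a (y : ℝ)) a :=
    (hasDerivWithinAt_const a _ (0 : ℝ)).congr hzero h3
  have huniq := (uniqueDiffOn_Icc hy a ⟨le_rfl, hy.le⟩).eq_deriv _ hder (h1 a).hasDerivWithinAt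
  rw [h4] at huniq
  exact zero_ne_one huniq

/-- A nonnegative solution of the initial value problem has no zero in `(a, b)`, since such a zero
would be a double zero. -/
theorem shoot_volterra_ne_zero_of_forall_nonneg (hab : a ≤ b) (p : C(Icc a b, ℝ))
    (hu : ∀ y, 0 ≤ shoot (volterra hab p) y) (y : Icc a b) (hy : (y : ℝ) ∈ Ioo a b) :
    shoot (volterra hab p) y ≠ 0 := by
  intro h0
  obtain ⟨w, w', h1, h2, h3, h4, h5⟩ := exists_hasDerivAt_shoot hab p
  set u := shoot (volterra hab p)
  have hwy : w y = 0 := (h5 y).trans h0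
  have hmin : IsLocalMin w y := by
    filter_upwards [Icc_mem_nhds hy.1 hy.2] with x hx
    rw [hwy]
    exact (hu ⟨x, hx⟩).trans (h5 ⟨x, hx⟩).ge
  have hw'y : w' y = 0 := hmin.hasDerivAt_eq_zero (h1 y)
  -- uniqueness for the initial value problem at `y`, run backwards to `a`
  have hf : ∀ s, HasDerivAt (fun s : ℝ => (w (y - s), w' (y - s)))
      (-w' (y - s), -(IccExtend hab p (y - s) * IccExtend hab u (y - s))) s := by
    intro s
    have hs : HasDerivAt (fun s : ℝ => (y : ℝ) - s) (-1) s := (hasDerivAt_id s).const_sub _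
    refine HasDerivAt.prodMk ?_ ?_
    · exact ((h1 _).comp s hs).congr_deriv (by ring)
    · exact ((h2 _).comp s hs).congr_deriv (by ring)
  have hz := eq_zero_of_abs_deriv_le_mul_abs_self_of_eq_zero_right (K := max 1 ‖p‖)
    (a := 0) (b := y - a) (fun s _ => (hf s).continuousAt.continuousWithinAt)
    (fun s _ => (hf s).hasDerivWithinAt) (by simp [hwy, hw'y]) (fun s hs => ?_) (y - a)
    ⟨by linarith [hy.1], le_rfl⟩
  · have := congrArg Prod.snd hz
    simp [h4] at this
  · have hs' : (y : ℝ) - s ∈ Icc a b := ⟨by linarith [hs.2], by linarith [hs.1, hy.2]⟩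
    have e1 : IccExtend hab u (y - s) = w (y - s) := by
      rw [IccExtend_of_mem _ _ hs']; exact (h5 ⟨_, hs'⟩).symm
    rw [e1]
    simp only [Prod.norm_def, norm_neg, norm_mul]
    have m1 : (0 : ℝ) ≤ max 1 ‖p‖ := zero_le_one.trans (le_max_left _ _)
    refine max_le ?_ ?_
    · calc ‖w' (y - s)‖ = 1 * ‖w' (y - s)‖ := (one_mul _).symm
        _ ≤ _ := mul_le_mul (le_max_left _ _) (le_max_right _ _) (norm_nonneg _) m1
    · exact mul_le_mul ((norm_extend_Icc_le hab p _).trans (le_max_right _ _)) (le_max_left _ _)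
        (norm_nonneg _) m1

theorem shoot_volterra_ge (hab : a ≤ b) (p : C(Icc a b, ℝ)) (y : Icc a b) :
    ((y : ℝ) - a) * (1 - ‖p‖ * ‖shoot (volterra hab p)‖ * (y - a)) ≤ shoot (volterra hab p) y := by
  set u := shoot (volterra hab p) with hu
  have h1 : u y = ((y : ℝ) - a) + doubleIntegral ℝ hab (p * u) y :=
    congrArg (fun f : C(Icc a b, ℝ) => f y) (shoot_volterra_eq hab p)
  have hy : (y : ℝ) ∈ Icc a b := y.2
  have h2 : ‖doubleIntegral ℝ hab (p * u) y‖ ≤ ((y : ℝ) - a) * (‖p‖ * ‖u‖) * |(y : ℝ) - a| := by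
    rw [doubleIntegral_apply]
    refine intervalIntegral.norm_integral_le_of_norm_le_const fun s hs => ?_
    rw [uIoc_of_le hy.1] at hs
    rw [norm_smul]
    have h3 : ‖(y : ℝ) - s‖ ≤ y - a := by
      rw [Real.norm_eq_abs, abs_le]; constructor <;> linarith [hs.1, hs.2]
    have h4 : ‖IccExtend hab ⇑(p * u) s‖ ≤ ‖p‖ * ‖u‖ :=
      (norm_extend_Icc_le hab (p * u) s).trans (norm_mul_le _ _)
    exact mul_le_mul h3 h4 (norm_nonneg _) (by linarith [hy.1])
  rw [abs_of_nonneg (by linarith [hy.1])] at h2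
  have h5 := (abs_le.1 h2).1
  rw [h1]
  nlinarith

/-- If the initial value problem at the spectral parameter `lam` has a solution with a zero in
`(a, b]`, then at some parameter `lam₁ ≤ lam` it has a solution which is positive in `(a, b)` and
vanishes at `b`: `lam₁` is the lowest Dirichlet eigenvalue. -/
theorem exists_lowest_eigenvalue (hab : a < b) (q : C(Icc a b, ℝ)) {lam : ℝ}
    (hz : ∃ y : Icc a b, a < y ∧ shoot (volterra hab.le (q - algebraMap ℝ _ lam)) y = 0) :
    ∃ lam₁ ≤ lam, shoot (volterra hab.le (q - algebraMap ℝ _ lam₁)) ⟨b, hab.le, le_rfl⟩ = 0 ∧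
      ∀ y : Icc a b, (y : ℝ) ∈ Ioo a b →
        0 < shoot (volterra hab.le (q - algebraMap ℝ _ lam₁)) y := by
  set U : ℝ → C(Icc a b, ℝ) := fun μ => shoot (volterra hab.le (q - algebraMap ℝ _ μ)) with hU
  have hUc : Continuous U := continuous_shoot_volterra_sub_const hab.le q
  have hlow : ∀ μ ≤ -‖q‖, ∀ y : Icc a b, a < y → U μ y ≠ 0 := by
    intro μ hμ y hy
    refine shoot_volterra_ne_zero_of_nonneg hab.le _ (fun x => ?_) y hy
    have := (abs_le.1 (q.norm_coe_le_norm x)).1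
    simp
    linarith
  obtain ⟨y₀, hy₀, hy₀z⟩ := hz
  -- near `a` the solutions are positive, uniformly in the spectral parameter
  obtain ⟨C, hC⟩ : ∃ C, ∀ μ ∈ Icc (-‖q‖) lam, ‖q - algebraMap ℝ C(Icc a b, ℝ) μ‖ * ‖U μ‖ ≤ C := by
    have hc : Continuous fun μ : ℝ => ‖q - algebraMap ℝ C(Icc a b, ℝ) μ‖ * ‖U μ‖ :=
      ((continuous_const.sub (continuous_algebraMap ℝ _)).norm).mul hUc.norm
    obtain ⟨C, hC⟩ := (isCompact_Icc (a := -‖q‖) (b := lam)).bddAbove_image hc.continuousOn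
    exact ⟨C, fun μ hμ => hC (mem_image_of_mem _ hμ)⟩
  set δ : ℝ := (|C| + 1)⁻¹ with hδ
  have hδ0 : 0 < δ := by positivity
  have hnear : ∀ μ ∈ Icc (-‖q‖) lam, ∀ y : Icc a b, a < y → (y : ℝ) < a + δ → 0 < U μ y := by
    intro μ hμ y hy1 hy2
    refine lt_of_lt_of_le ?_ (shoot_volterra_ge hab.le _ y)
    have h1 : 0 < (y : ℝ) - a := by linarith
    refine mul_pos h1 ?_
    have h2 : ‖q - algebraMap ℝ C(Icc a b, ℝ) μ‖ * ‖U μ‖ * (y - a) ≤ |C| * (y - a) := by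
      gcongr
      exact (hC μ hμ).trans (le_abs_self C)
    have h3 : |C| * ((y : ℝ) - a) < 1 := by
      have : (|C| + 1) * δ = 1 := mul_inv_cancel₀ (by positivity)
      nlinarith [abs_nonneg C]
    have h4 : ‖q - algebraMap ℝ C(Icc a b, ℝ) μ‖ * ‖U μ‖ * (y - a) < 1 := h2.trans_lt h3
    linarith
  have hlam : -‖q‖ < lam := by
    by_contra h
    exact hlow lam (not_lt.1 h) y₀ hy₀ hy₀z
  set K : Set (ℝ × Icc a b) := {x | x.1 ∈ Icc (-‖q‖) lam ∧ a + δ ≤ x.2 ∧ U x.1 x.2 = 0} with hK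
  have hUe : Continuous fun x : ℝ × Icc a b => U x.1 x.2 :=
    (hUc.comp continuous_fst).eval continuous_snd
  have hKc : IsCompact K := by
    refine (isCompact_Icc.prod isCompact_univ).of_isClosed_subset
      (s := Icc (-‖q‖) lam ×ˢ (univ : Set (Icc a b))) ?_ fun x hx => ⟨hx.1, mem_univ _⟩
    exact (isClosed_Icc.preimage continuous_fst).inter
      ((isClosed_le continuous_const (continuous_subtype_val.comp continuous_snd)).inter
        (isClosed_eq hUe continuous_const))
  have hmemK : ∀ μ ≤ lam, ∀ y : Icc a b, a < y → U μ y = 0 → (μ, y) ∈ K := by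
    intro μ hμ y hy hy0
    have h1 : -‖q‖ ≤ μ := by
      by_contra h
      exact hlow μ (not_le.1 h).le y hy hy0
    refine ⟨⟨h1, hμ⟩, ?_, hy0⟩
    by_contra h
    exact (hnear μ ⟨h1, hμ⟩ y hy (not_le.1 h)).ne' hy0
  obtain ⟨⟨lam₁, y₁⟩, hmem, hminK⟩ := hKc.exists_isMinOn ⟨(lam, y₀), hmemK lam le_rfl y₀ hy₀ hy₀z⟩
    continuous_fst.continuousOn
  have hlow1 : -‖q‖ < lam₁ := by
    by_contra h
    exact hlow lam₁ (not_lt.1 h) y₁ (by linarith [hmem.2.1]) hmem.2.2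
  have hnz : ∀ μ < lam₁, ∀ y : Icc a b, a < y → U μ y ≠ 0 := by
    intro μ hμ y hy hy0
    have := hminK (hmemK μ (hμ.le.trans hmem.1.2) y hy hy0)
    exact absurd hμ (not_lt.2 this)
  have hpos : ∀ μ ∈ Ioo (-‖q‖) lam₁, ∀ y : Icc a b, a < y → 0 < U μ y := by
    intro μ hμ y hy
    by_contra hle
    have hμ' : μ ∈ Icc (-‖q‖) lam := ⟨hμ.1.le, hμ.2.le.trans hmem.1.2⟩
    have hyb := y.2.2
    have hmin : 0 < min ((y : ℝ) - a) δ := lt_min (by linarith) hδ0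
    let z : Icc a b := ⟨a + min ((y : ℝ) - a) δ / 2, by linarith,
      by linarith [min_le_left ((y : ℝ) - a) δ]⟩
    have hz1 : a < z := show a < a + min ((y : ℝ) - a) δ / 2 by linarith
    have hz2 : (z : ℝ) < a + δ :=
      show a + min ((y : ℝ) - a) δ / 2 < a + δ by linarith [min_le_right ((y : ℝ) - a) δ]
    have hz3 : z ≤ y :=
      show a + min ((y : ℝ) - a) δ / 2 ≤ (y : ℝ) by linarith [min_le_left ((y : ℝ) - a) δ]
    have hzp := hnear μ hμ' z hz1 hz2
    have hw : ContinuousOn (IccExtend hab.le (U μ)) (Icc (z : ℝ) y) :=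
      (continuous_extend_Icc hab.le (U μ)).continuousOn
    obtain ⟨x, hx, hx0⟩ := intermediate_value_Icc' (show (z : ℝ) ≤ y from hz3) hw
      (show (0 : ℝ) ∈ Icc _ _ by
        rw [IccExtend_val, IccExtend_val]
        exact ⟨not_lt.1 hle, hzp.le⟩)
    have hxm : x ∈ Icc a b := ⟨hz1.le.trans hx.1, hx.2.trans hyb⟩
    rw [IccExtend_of_mem _ _ hxm] at hx0
    exact hnz μ hμ.2 ⟨x, hxm⟩ (hz1.trans_le hx.1) hx0
  have hnonneg : ∀ y : Icc a b, 0 ≤ U lam₁ y := by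
    intro y
    rcases eq_or_lt_of_le y.2.1 with hy | hy
    · have := shoot_volterra_ge hab.le (q - algebraMap ℝ _ lam₁) y
      rw [← hy, sub_self, zero_mul] at this
      exact this
    · have hc : ContinuousWithinAt (fun μ => U μ y) (Iio lam₁) lam₁ :=
        (hUe.comp (Continuous.prodMk_left y)).continuousWithinAt
      refine ge_of_tendsto hc ?_
      filter_upwards [Ioo_mem_nhdsLT hlow1] with μ hμ
      exact (hpos μ hμ y hy).le
  have hne := shoot_volterra_ne_zero_of_forall_nonneg hab.le (q - algebraMap ℝ _ lam₁) hnonneg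
  refine ⟨lam₁, hmem.1.2, ?_, fun y hy => lt_of_le_of_ne (hnonneg y) (hne y hy).symm⟩
  have hy₁ : (y₁ : ℝ) = b := by
    by_contra h
    exact hne y₁ ⟨by linarith [hmem.2.1], lt_of_le_of_ne y₁.2.2 h⟩ hmem.2.2
  have : y₁ = ⟨b, hab.le, le_rfl⟩ := Subtype.ext hy₁
  rw [← this]
  exact hmem.2.2

end LowestEigenvalue

/-! ### Dirichlet eigenfunctions and the initial value problem -/

section Eigenfunction

open Filter Topology

variable {𝕜 : Type*} [RCLike 𝕜] {a b : ℝ}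

/-- A zero at `b` of the solution of the initial value problem gives a Dirichlet solution. -/
theorem exists_isNonzeroDirichlet_of_shoot_eq_zero (hab : a < b) (p : C(Icc a b, 𝕜))
    (hb : shoot (volterra hab.le p) ⟨b, hab.le, le_rfl⟩ = 0) :
    ∃ v : ℝ → 𝕜, IsNonzeroDirichlet a b v ∧
      ∀ y ∈ Ioo a b, deriv (deriv v) y = IccExtend hab.le p y * v y := by
  obtain ⟨w, w', h1, h2, h3, h4, h5⟩ := exists_hasDerivAt_shoot hab.le p
  have hd : deriv w = w' := funext fun y => (h1 y).deriv
  refine ⟨w, ⟨fun y _ => (h1 y).continuousAt.continuousWithinAt, h3, (h5 _).trans hb, ?_,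
    fun y _ => (h1 y).differentiableAt, fun y _ => ?_⟩, fun y hy => ?_⟩
  · by_contra! hzero
    have hz : ∀ y ∈ Ico a b, w y = 0 := by
      intro y hy
      rcases eq_or_lt_of_le hy.1 with h | h
      · rw [← h, h3]
      · exact hzero y ⟨h, hy.2⟩
    have hder : HasDerivWithinAt w 0 (Ico a b) a := (hasDerivWithinAt_const a _ (0 : 𝕜)).congr hz h3
    have huniq := (uniqueDiffOn_Ico a b a ⟨le_rfl, hab⟩).eq_deriv _ hder (h1 a).hasDerivWithinAt
    rw [h4] at huniq
    exact zero_ne_one huniq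
  · rw [hd]; exact (h2 y).differentiableAt
  · have hy' := Ioo_subset_Icc_self hy
    rw [hd, (h2 y).deriv, IccExtend_of_mem _ (shoot (volterra hab.le p)) hy', ← h5 ⟨y, hy'⟩]

/-- At a Dirichlet eigenvalue the solution of the initial value problem has a zero in `(a, b]`.
No one-sided derivative of the eigenfunction at `a` is assumed: the equation bounds its derivative
near `a`, so that its Wronskian with the solution of the initial value problem tends to zero. -/
theorem exists_shoot_eq_zero_of_isNonzeroDirichlet (hab : a < b) (p : C(Icc a b, ℝ)) {v : ℝ → ℝ}
    (hv : IsNonzeroDirichlet a b v)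
    (heq : ∀ y ∈ Ioo a b, deriv (deriv v) y = IccExtend hab.le p y * v y) :
    ∃ y : Icc a b, a < y ∧ shoot (volterra hab.le p) y = 0 := by
  by_contra! hne
  obtain ⟨w, w', h1, h2, h3, h4, h5⟩ := exists_hasDerivAt_shoot hab.le p
  have hwne : ∀ y ∈ Ioc a b, w y ≠ 0 := fun y hy => by
    rw [h5 ⟨y, hy.1.le, hy.2⟩]; exact hne _ hy.1
  obtain ⟨B, hB⟩ : ∃ B, ∀ y ∈ Icc a b, ‖IccExtend hab.le p y * v y‖ ≤ B :=
    isCompact_Icc.exists_bound_of_continuousOn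
      ((continuous_extend_Icc hab.le p).continuousOn.mul hv.continuousOn)
  set m := (a + b) / 2 with hm
  have hmI : m ∈ Ioo a b := ⟨by linarith, by linarith⟩
  have hbdd : ∀ y ∈ Ioo a b, ‖deriv v y‖ ≤ ‖deriv v m‖ + B * (b - a) := by
    intro y hy
    have h6 := (convex_Ioo a b).norm_image_sub_le_of_norm_deriv_le (f := deriv v)
      (fun x hx => hv.differentiableAt_deriv x hx)
      (fun x hx => by rw [heq x hx]; exact hB x (Ioo_subset_Icc_self hx)) hmI hy
    have h7 : ‖y - m‖ ≤ b - a := by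
      rw [Real.norm_eq_abs, abs_le]; constructor <;> linarith [hy.1, hy.2, hmI.1, hmI.2]
    have hB0 : 0 ≤ B := (norm_nonneg _).trans (hB m (Ioo_subset_Icc_self hmI))
    have h8 : ‖deriv v y‖ ≤ ‖deriv v m‖ + ‖deriv v y - deriv v m‖ := by
      have := norm_add_le (deriv v m) (deriv v y - deriv v m)
      rwa [add_sub_cancel] at this
    have := mul_le_mul_of_nonneg_left h7 hB0
    linarith
  set Wr : ℝ → ℝ := fun y => v y * w' y - deriv v y * w y with hWr
  have hWd : ∀ y ∈ Ioo a b, HasDerivAt Wr 0 y := by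
    intro y hy
    have hy' := Ioo_subset_Icc_self hy
    have e1 := ((hv.differentiableAt y hy).hasDerivAt.mul (h2 y)).sub
      ((hv.differentiableAt_deriv y hy).hasDerivAt.mul (h1 y))
    refine e1.congr_deriv ?_
    rw [heq y hy, IccExtend_of_mem _ (shoot (volterra hab.le p)) hy', ← h5 ⟨y, hy'⟩]
    ring
  have hconst : ∀ y ∈ Ioo a b, Wr y = Wr m := fun y hy =>
    isOpen_Ioo.is_const_of_deriv_eq_zero isPreconnected_Ioo
      (fun x hx => (hWd x hx).differentiableAt.differentiableWithinAt)
      (fun x hx => (hWd x hx).deriv) hy hmI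
  have hlim : Tendsto Wr (𝓝[>] a) (𝓝 0) := by
    have t1 : Tendsto v (𝓝[>] a) (𝓝 0) := by
      have := (hv.continuousOn a ⟨le_rfl, hab.le⟩).mono_left
        (nhdsWithin_le_of_mem (mem_of_superset (Ioo_mem_nhdsGT hab) Ioo_subset_Icc_self))
      rwa [hv.left] at this
    have t2 : Tendsto w' (𝓝[>] a) (𝓝 (w' a)) := (h2 a).continuousAt.tendsto.mono_left
      nhdsWithin_le_nhds
    have t3 : Tendsto w (𝓝[>] a) (𝓝 0) := by
      have := (h1 a).continuousAt.tendsto.mono_left (nhdsWithin_le_nhds (s := Ioi a))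
      rwa [h3] at this
    have t4 : Tendsto (fun y => deriv v y * w y) (𝓝[>] a) (𝓝 0) := by
      refine bdd_le_mul_tendsto_zero' (‖deriv v m‖ + B * (b - a)) ?_ t3
      filter_upwards [Ioo_mem_nhdsGT hab] with y hy
      exact hbdd y hy
    simpa using (t1.mul t2).sub t4
  have hWm : Wr m = 0 := by
    refine tendsto_nhds_unique (tendsto_const_nhds.congr' ?_) hlim
    filter_upwards [Ioo_mem_nhdsGT hab] with y hy
    exact (hconst y hy).symm
  have hquot : ∀ y ∈ Ioo a b, HasDerivAt (fun y => v y / w y) 0 y := by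
    intro y hy
    refine ((hv.differentiableAt y hy).hasDerivAt.div (h1 y)
      (hwne y ⟨hy.1, hy.2.le⟩)).congr_deriv ?_
    have := (hconst y hy).trans hWm
    simp only [hWr] at this
    rw [div_eq_zero_iff]
    left
    linarith
  obtain ⟨y₀, hy₀, hvy₀⟩ := hv.nonzero
  have hcont : ContinuousOn (fun y => v y / w y) (Icc y₀ b) := by
    refine (hv.continuousOn.mono (Icc_subset_Icc hy₀.1.le le_rfl)).div
      (fun y _ => (h1 y).continuousAt.continuousWithinAt) fun y hy =>
        hwne y ⟨hy₀.1.trans_le hy.1, hy.2⟩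
  obtain ⟨c, hc, hc'⟩ := exists_hasDerivAt_eq_slope _ (fun _ => (0 : ℝ)) hy₀.2 hcont
    fun y hy => hquot y ⟨hy₀.1.trans hy.1, hy.2⟩
  rw [hv.right, zero_div, eq_comm, div_eq_zero_iff] at hc'
  rcases hc' with h | h
  · rw [zero_sub, neg_eq_zero, div_eq_zero_iff] at h
    exact h.elim hvy₀ (hwne y₀ ⟨hy₀.1, hy₀.2.le⟩)
  · linarith [hy₀.2]

end Eigenfunction

/-! ### Curves of parameters at which an analytic function is real -/

section RealCurve

open Filter Topology

/-- If a holomorphic function with negative real part takes values in both open half-planes on a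
connected set, then it takes the value `-α²` along a continuous curve parametrized by `α`. The
curve starts at a point where the derivative does not vanish; such a point exists because the zeros
of the derivative are isolated and the function is open. -/
theorem exists_continuousOn_eq_neg_sq {S Γ : Set ℂ} (hS : IsOpen S) {ν : ℂ → ℂ}
    (hν : DifferentiableOn ℂ ν S) (hre : ∀ c ∈ S, (ν c).re < 0) (hΓS : Γ ⊆ S)
    (hΓ : IsPreconnected Γ) {p q : ℂ} (hp : p ∈ Γ) (hq : q ∈ Γ)
    (hpq : (ν p).im * (ν q).im < 0) :
    ∃ α₁ α₂ : ℝ, 0 ≤ α₁ ∧ α₁ < α₂ ∧ ∃ c : ℝ → ℂ, ContinuousOn c (Ioo α₁ α₂) ∧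
      ∀ α ∈ Ioo α₁ α₂, c α ∈ S ∧ ν (c α) = -(α : ℂ) ^ 2 := by
  have han : AnalyticOnNhd ℂ ν S := hν.analyticOnNhd hS
  have hcont : ContinuousOn (fun c => (ν c).im) Γ :=
    Complex.continuous_im.comp_continuousOn (hν.continuousOn.mono hΓS)
  obtain ⟨c₀, hc₀, hc₀im⟩ : ∃ c ∈ Γ, (ν c).im = 0 := by
    have hord := hΓ.image _ hcont
    have h0 : (0 : ℝ) ∈ (fun c => (ν c).im) '' Γ := by
      rcases mul_neg_iff.1 hpq with h | h
      · exact hord.ordConnected.out (mem_image_of_mem _ hq) (mem_image_of_mem _ hp)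
          ⟨h.2.le, h.1.le⟩
      · exact hord.ordConnected.out (mem_image_of_mem _ hp) (mem_image_of_mem _ hq)
          ⟨h.1.le, h.2.le⟩
    exact h0
  have hc₀S := hΓS hc₀
  -- the function is not constant near `c₀`
  have hnc : ¬ ∀ᶠ c in 𝓝 c₀, ν c = ν c₀ := by
    intro hev
    have heq := (han.mono hΓS).eqOn_of_preconnected_of_eventuallyEq
      (g := fun _ => ν c₀) analyticOnNhd_const hΓ hc₀ hev
    rw [heq hp, heq hq] at hpq
    exact absurd hpq (not_lt.2 (mul_self_nonneg _))
  have hopen := ((han c₀ hc₀S).eventually_constant_or_nhds_le_map_nhds).resolve_left hnc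
  have hder : ∀ᶠ c in 𝓝[≠] c₀, deriv ν c ≠ 0 := by
    refine ((han c₀ hc₀S).deriv.eventually_eq_zero_or_eventually_ne_zero).resolve_left fun hz => ?_
    obtain ⟨ε, hε, hball⟩ := Metric.eventually_nhds_iff_ball.1 (hz.and (hS.mem_nhds hc₀S))
    refine hnc (mem_of_superset (Metric.ball_mem_nhds c₀ hε) fun c hc => ?_)
    exact Metric.isOpen_ball.is_const_of_deriv_eq_zero (convex_ball c₀ ε).isPreconnected
      (hν.mono fun x hx => (hball x hx).2) (fun x hx => (hball x hx).1) hc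
      (Metric.mem_ball_self hε)
  obtain ⟨c₁, hc₁S, hc₁im, hc₁d⟩ : ∃ c ∈ S, (ν c).im = 0 ∧ deriv ν c ≠ 0 := by
    have hN : {c | c ∈ S ∧ (c ≠ c₀ → deriv ν c ≠ 0)} ∈ 𝓝 c₀ :=
      Eventually.and (hS.mem_nhds hc₀S) (eventually_nhdsWithin_iff.1 hder)
    have himg := hopen (image_mem_map hN)
    have htend : Tendsto (fun t : ℝ => ν c₀ + (t : ℂ)) (𝓝[≠] 0) (𝓝 (ν c₀)) := by
      have h1 : Continuous fun t : ℝ => ν c₀ + (t : ℂ) := by fun_prop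
      have := h1.tendsto 0
      simp only [Complex.ofReal_zero, add_zero] at this
      exact this.mono_left nhdsWithin_le_nhds
    obtain ⟨t, ⟨c, hc, hct⟩, ht⟩ :=
      (Eventually.and (htend.eventually himg) self_mem_nhdsWithin).exists
    refine ⟨c, hc.1, by rw [hct]; simp [hc₀im], hc.2 ?_⟩
    rintro rfl
    have : (t : ℂ) = 0 := by simpa using hct
    exact ht (by exact_mod_cast this)
  have hc₁neg := hre c₁ hc₁S
  have hstrict : HasStrictDerivAt ν (deriv ν c₁) c₁ := (han c₁ hc₁S).hasStrictDerivAt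
  have hstrict' := hstrict.hasStrictFDerivAt_equiv hc₁d
  set Φ := hstrict'.toOpenPartialHomeomorph ν with hΦ
  have hΦν : ∀ c, Φ c = ν c := fun c => rfl
  have hsrc : c₁ ∈ Φ.source := hstrict'.mem_toOpenPartialHomeomorph_source
  have htgt : ν c₁ ∈ Φ.target := hstrict'.image_mem_toOpenPartialHomeomorph_target
  have hinv : Φ.symm (ν c₁) = c₁ := Φ.left_inv hsrc
  set α₀ := Real.sqrt (-(ν c₁).re) with hα₀
  have hα₀pos : 0 < α₀ := Real.sqrt_pos.2 (by linarith)
  have hsq : -(α₀ : ℂ) ^ 2 = ν c₁ := by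
    have h1 : α₀ ^ 2 = -(ν c₁).re := Real.sq_sqrt (by linarith)
    apply Complex.ext <;> rw [← Complex.ofReal_pow, h1] <;> simp [hc₁im]
  have hα : Continuous fun α : ℝ => -(α : ℂ) ^ 2 := by fun_prop
  have hev : ∀ᶠ α : ℝ in 𝓝 α₀, -(α : ℂ) ^ 2 ∈ Φ.target ∧ Φ.symm (-(α : ℂ) ^ 2) ∈ S := by
    have h1 : Tendsto (fun α : ℝ => -(α : ℂ) ^ 2) (𝓝 α₀) (𝓝 (ν c₁)) := by
      rw [← hsq]; exact hα.tendsto α₀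
    have h2 : ∀ᶠ z in 𝓝 (ν c₁), Φ.symm z ∈ S := by
      refine (Φ.continuousAt_symm htgt).eventually ?_
      rw [hinv]
      exact hS.mem_nhds hc₁S
    have h3 : ∀ᶠ z in 𝓝 (ν c₁), z ∈ Φ.target := Φ.open_target.mem_nhds htgt
    exact h1.eventually (h3.and h2)
  obtain ⟨ε, hε, hball⟩ := Metric.eventually_nhds_iff_ball.1 hev
  have hsub : ∀ α ∈ Ioo (max 0 (α₀ - ε)) (α₀ + ε), α ∈ Metric.ball α₀ ε := by
    intro α hα
    rw [Real.ball_eq_Ioo]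
    exact ⟨(le_max_right _ _).trans_lt hα.1, hα.2⟩
  refine ⟨max 0 (α₀ - ε), α₀ + ε, le_max_left _ _, max_lt (by linarith) (by linarith),
    fun α => Φ.symm (-(α : ℂ) ^ 2), ?_, fun α hα => ⟨(hball α (hsub α hα)).2, ?_⟩⟩
  · exact Φ.continuousOn_symm.comp hα.continuousOn fun α hα => (hball α (hsub α hα)).1
  · exact Φ.right_inv (hball α (hsub α hα)).1

end RealCurve

/-! ### The potential near the critical layer -/

section CriticalLayer

open Filter Topology

/-- Quantitative data of a profile `H` with an inflection point `ys`: `h` stands for `H''`, extended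
continuously to the closed interval, `K` for the potential `H'' / (H - H(ys))`; `δ` is the
half-width of a neighbourhood of `ys` on which `H` expands distances by a factor at least `m` and
`h` has opposite strict signs on the two sides of `ys`; `M` and `C` are Lipschitz constants of `H`
and `h` on the whole interval. -/
structure InflectionProfile (a b ys δ m M C : ℝ) (H h K : ℝ → ℝ) : Prop where
  δ_pos : 0 < δ
  m_pos : 0 < m
  M_pos : 0 < M
  C_pos : 0 < C
  left_lt : a < ys - δ
  lt_right : ys + δ < b
  continuousOn_H : ContinuousOn H (Icc a b)
  continuousOn_h : ContinuousOn h (Icc a b)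
  continuousOn_K : ContinuousOn K (Icc a b)
  injOn : InjOn H (Icc a b)
  lipschitz_H : ∀ y ∈ Icc a b, ∀ z ∈ Icc a b, |H y - H z| ≤ M * |y - z|
  lipschitz_h : ∀ y ∈ Icc a b, ∀ z ∈ Icc a b, |h y - h z| ≤ C * |y - z|
  expand : ∀ y ∈ Icc (ys - δ) (ys + δ), ∀ z ∈ Icc (ys - δ) (ys + δ), m * |y - z| ≤ |H y - H z|
  K_mul : ∀ y ∈ Icc a b, K y * (H y - H ys) = h y
  h_ys : h ys = 0
  sign : ∀ y ∈ Ico (ys - δ) ys, ∀ z ∈ Ioc ys (ys + δ), h y * h z < 0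

variable {a b ys δ m M C : ℝ} {H h K : ℝ → ℝ}

namespace InflectionProfile

theorem window_subset (P : InflectionProfile a b ys δ m M C H h K) :
    Icc (ys - δ) (ys + δ) ⊆ Icc a b := Icc_subset_Icc P.left_lt.le P.lt_right.le

theorem ys_mem (P : InflectionProfile a b ys δ m M C H h K) : ys ∈ Icc a b :=
  P.window_subset ⟨by linarith [P.δ_pos], by linarith [P.δ_pos]⟩

theorem mem_window {y : ℝ} (hy : |y - ys| ≤ δ) : y ∈ Icc (ys - δ) (ys + δ) := by
  rw [abs_le] at hy
  constructor <;> linarith [hy.1, hy.2]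

/-- Away from `ys` the profile stays away from its value there. -/
theorem exists_gap (P : InflectionProfile a b ys δ m M C H h K) {τ : ℝ} (hτ : 0 < τ) :
    ∃ g > 0, ∀ y ∈ Icc a b, τ ≤ |y - ys| → g ≤ |H y - H ys| := by
  have hcomp : IsCompact (Icc a b ∩ {y | τ ≤ |y - ys|}) :=
    isCompact_Icc.inter_right (isClosed_le continuous_const (by fun_prop))
  rcases (Icc a b ∩ {y | τ ≤ |y - ys|}).eq_empty_or_nonempty with he | hne
  · exact ⟨1, one_pos, fun y hy hyτ => absurd (show y ∈ Icc a b ∩ {y | τ ≤ |y - ys|} from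
      ⟨hy, hyτ⟩) (by rw [he]; exact notMem_empty y)⟩
  · obtain ⟨y₀, hy₀, hmin⟩ := hcomp.exists_isMinOn (f := fun y => |H y - H ys|) hne
      ((P.continuousOn_H.mono inter_subset_left).sub continuousOn_const).abs
    refine ⟨|H y₀ - H ys|, ?_, fun y hy hyτ => hmin ⟨hy, hyτ⟩⟩
    refine abs_pos.2 (sub_ne_zero.2 fun heq => ?_)
    have := P.injOn hy₀.1 P.ys_mem heq
    have h2 : τ ≤ |y₀ - ys| := hy₀.2
    rw [this, sub_self, abs_zero] at h2
    linarith

theorem abs_h_le (P : InflectionProfile a b ys δ m M C H h K) {y : ℝ} (hy : y ∈ Icc a b) :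
    |h y| ≤ C * |y - ys| := by
  simpa [P.h_ys] using P.lipschitz_h y hy ys P.ys_mem

/-- The antiderivative `arsinh (m (y - y₀) / s) / m` controls `1 / |H - c|` for
`c = H(y₀) + i s`. -/
theorem integral_inv_sqrt_le {m s L : ℝ} (hm : 0 < m) (hs : 0 < s) {α β y₀ : ℝ}
    (hα : m * |α - y₀| ≤ L) (hβ : m * |β - y₀| ≤ L) :
    ∫ y in α..β, s⁻¹ * (√(1 + (m * (y - y₀) / s) ^ 2))⁻¹ ≤ 2 * Real.arsinh (L / s) / m := by
  have hd : ∀ y, HasDerivAt (fun y => Real.arsinh (m * (y - y₀) / s) / m)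
      (s⁻¹ * (√(1 + (m * (y - y₀) / s) ^ 2))⁻¹) y := by
    intro y
    have h1 : HasDerivAt (fun y => m * (y - y₀) / s) (m / s) y := by
      simpa using (((hasDerivAt_id y).sub_const y₀).const_mul m).div_const s
    refine (h1.arsinh.div_const m).congr_deriv ?_
    simp only [smul_eq_mul]
    field_simp
  have hc : Continuous fun y => s⁻¹ * (√(1 + (m * (y - y₀) / s) ^ 2))⁻¹ := by
    refine continuous_const.mul (Continuous.inv₀ (by fun_prop) fun y => ?_)
    positivity
  rw [intervalIntegral.integral_eq_sub_of_hasDerivAt (fun y _ => hd y) (hc.intervalIntegrable _ _),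
    ← sub_div]
  have hb : ∀ y, m * |y - y₀| ≤ L → |Real.arsinh (m * (y - y₀) / s)| ≤ Real.arsinh (L / s) := by
    intro y hy
    have h2 : |m * (y - y₀) / s| ≤ L / s := by
      rw [abs_div, abs_mul, abs_of_pos hm, abs_of_pos hs]
      gcongr
    rw [abs_le] at h2 ⊢
    constructor
    · rw [← Real.arsinh_neg, Real.arsinh_le_arsinh]; exact h2.1
    · rw [Real.arsinh_le_arsinh]; exact h2.2
  have h3 := (abs_le.1 (hb α hα)).1
  have h4 := (abs_le.1 (hb β hβ)).2
  gcongr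
  linarith

/-- The complex number `H(y₀) + i s`. -/
noncomputable def point (H : ℝ → ℝ) (y₀ s : ℝ) : ℂ := ⟨H y₀, s⟩

theorem norm_sub_point (H : ℝ → ℝ) (y y₀ s : ℝ) :
    ‖(H y : ℂ) - point H y₀ s‖ = √((H y - H y₀) ^ 2 + s ^ 2) := by
  rw [Complex.norm_def, Complex.normSq_apply]
  simp [point]
  ring_nf

theorem le_norm_sub_point (H : ℝ → ℝ) (y y₀ : ℝ) {s : ℝ} :
    |H y - H y₀| ≤ ‖(H y : ℂ) - point H y₀ s‖ := by
  have := Complex.abs_re_le_norm ((H y : ℂ) - point H y₀ s)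
  simpa [point] using this

theorem sub_point_ne_zero (H : ℝ → ℝ) (y y₀ : ℝ) {s : ℝ} (hs : 0 < s) :
    (H y : ℂ) - point H y₀ s ≠ 0 := by
  intro h0
  have := congrArg Complex.im h0
  simp [point] at this
  exact hs.ne' this

/-- In the `L¹` norm, `H'' / (H - c)` is close to `H'' / (H - H(ys))` when `c = H(y₀) + i s` is close
to `H(ys)`, except at heights `s` exponentially small in terms of `H''(y₀)`. -/
theorem exists_integral_norm_sub_le (P : InflectionProfile a b ys δ m M C H h K) {η : ℝ}
    (hη : 0 < η) :
    ∃ θ > 0, ∀ y₀ s, |y₀ - ys| ≤ θ → 0 < s → s ≤ θ →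
      |h y₀| * Real.arsinh (m * (b - a) / s) ≤ θ →
      ∫ y in a..b, ‖(h y : ℂ) / ((H y : ℂ) - point H y₀ s) - (K y : ℂ)‖ ≤ η := by
  have hδ := P.δ_pos
  have hm := P.m_pos
  have hM := P.M_pos
  have hC := P.C_pos
  have hal := P.left_lt.le
  have hbr := P.lt_right.le
  obtain ⟨B, hB⟩ := isCompact_Icc.exists_bound_of_continuousOn P.continuousOn_K
  have hB0 : 0 ≤ B := (norm_nonneg _).trans (hB ys P.ys_mem)
  set D := C / m + B with hD
  have hD0 : 0 < D := by positivity
  set τ := min δ (η / (8 * D)) with hτ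
  have hτ0 : 0 < τ := lt_min hδ (by positivity)
  have hτδ : τ ≤ δ := min_le_left _ _
  have hτη : 2 * τ * D ≤ η / 4 := by
    have : τ ≤ η / (8 * D) := min_le_right _ _
    rw [le_div_iff₀ (by positivity)] at this
    linarith
  obtain ⟨g, hg0, hg⟩ := P.exists_gap hτ0
  set E := 2 * B * (M + 1) / g with hE
  have hE0 : 0 ≤ E := by positivity
  have hba : 0 < b - a := by linarith
  refine ⟨min (min δ (g / (2 * (M + 1)))) (min (η / (4 * (E + 1) * (b - a))) (m * η / 8)),
    by positivity, fun y₀ s hy₀ hs hsθ hars => ?_⟩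
  set θ := min (min δ (g / (2 * (M + 1)))) (min (η / (4 * (E + 1) * (b - a))) (m * η / 8)) with hθ
  have hθ0 : 0 < θ := lt_of_lt_of_le hs hsθ
  have hθ1 : θ ≤ δ := (min_le_left _ _).trans (min_le_left _ _)
  have hθ2 : (M + 1) * θ ≤ g / 2 := by
    have : θ ≤ g / (2 * (M + 1)) := (min_le_left _ _).trans (min_le_right _ _)
    rw [le_div_iff₀ (by positivity)] at this
    linarith
  have hθ3 : E * θ * (b - a) ≤ η / 4 := by
    have : θ ≤ η / (4 * (E + 1) * (b - a)) := (min_le_right _ _).trans (min_le_left _ _)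
    rw [le_div_iff₀ (by positivity)] at this
    nlinarith [mul_pos hθ0 hba]
  have hθ4 : 2 * θ / m ≤ η / 4 := by
    have : θ ≤ m * η / 8 := (min_le_right _ _).trans (min_le_right _ _)
    rw [div_le_iff₀ hm]
    linarith
  clear_value θ
  have hy₀w : y₀ ∈ Icc (ys - δ) (ys + δ) := mem_window (hy₀.trans hθ1)
  have hy₀I := P.window_subset hy₀w
  set c := point H y₀ s with hc
  have hne : ∀ y, (H y : ℂ) - c ≠ 0 := fun y => sub_point_ne_zero H y y₀ hs
  set f : ℝ → ℝ := fun y => ‖(h y : ℂ) / ((H y : ℂ) - c) - (K y : ℂ)‖ with hf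
  have hfc : ContinuousOn f (Icc a b) :=
    (((Complex.continuous_ofReal.comp_continuousOn P.continuousOn_h).div
      ((Complex.continuous_ofReal.comp_continuousOn P.continuousOn_H).sub continuousOn_const)
      fun y _ => hne y).sub (Complex.continuous_ofReal.comp_continuousOn P.continuousOn_K)).norm
  -- far from `ys`
  have hfar : ∀ y ∈ Icc a b, τ ≤ |y - ys| → f y ≤ E * θ := by
    intro y hy hyτ
    have hgy := hg y hy hyτ
    have hcs : ‖c - (H ys : ℂ)‖ ≤ (M + 1) * θ := by
      have e1 : c - (H ys : ℂ) = ((H y₀ - H ys : ℝ) : ℂ) + (s : ℂ) * Complex.I := by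
        apply Complex.ext <;> simp [hc, point]
      rw [e1]
      refine (norm_add_le _ _).trans ?_
      rw [norm_mul, Complex.norm_I, mul_one, Complex.norm_real, Complex.norm_real,
        Real.norm_eq_abs, Real.norm_eq_abs, abs_of_pos hs]
      have := P.lipschitz_H y₀ hy₀I ys P.ys_mem
      have := mul_le_mul_of_nonneg_left hy₀ hM.le
      linarith
    have hHc : g / 2 ≤ ‖(H y : ℂ) - c‖ := by
      have e2 : ((H y - H ys : ℝ) : ℂ) = ((H y : ℂ) - c) + (c - (H ys : ℂ)) := by
        push_cast; ring
      have e3 := norm_add_le ((H y : ℂ) - c) (c - (H ys : ℂ))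
      rw [← e2, Complex.norm_real, Real.norm_eq_abs] at e3
      linarith
    have e4 : (h y : ℂ) / ((H y : ℂ) - c) - (K y : ℂ)
        = (K y : ℂ) * (c - (H ys : ℂ)) / ((H y : ℂ) - c) := by
      rw [← P.K_mul y hy, eq_div_iff (hne y), sub_mul, div_mul_cancel₀ _ (hne y)]
      push_cast
      ring
    have e5 : ‖(K y : ℂ)‖ ≤ B := by rw [Complex.norm_real]; exact hB y hy
    simp only [hf]
    rw [e4, norm_div, norm_mul]
    calc ‖(K y : ℂ)‖ * ‖c - (H ys : ℂ)‖ / ‖(H y : ℂ) - c‖ ≤ B * ((M + 1) * θ) / (g / 2) := by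
          gcongr
      _ = E * θ := by rw [hE]; field_simp
  -- close to `ys`
  set k : ℝ → ℝ := fun y => s⁻¹ * (√(1 + (m * (y - y₀) / s) ^ 2))⁻¹ with hk
  have hkc : Continuous k := by
    refine continuous_const.mul (Continuous.inv₀ (by fun_prop) fun y => ?_)
    positivity
  have hclose : ∀ y ∈ Icc (ys - τ) (ys + τ), f y ≤ |h y₀| * k y + D := by
    intro y hy
    have hyw : y ∈ Icc (ys - δ) (ys + δ) := ⟨by linarith [hy.1], by linarith [hy.2]⟩
    have hyI := P.window_subset hyw
    have hex := P.expand y hyw y₀ hy₀w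
    have hpos : 0 < ‖(H y : ℂ) - c‖ := norm_pos_iff.2 (hne y)
    have e1 : ‖(H y : ℂ) - c‖⁻¹ ≤ k y := by
      have e2 : s * √(1 + (m * (y - y₀) / s) ^ 2) = √((m * (y - y₀)) ^ 2 + s ^ 2) := by
        rw [← Real.sqrt_sq hs.le, ← Real.sqrt_mul (by positivity), Real.sqrt_sq hs.le]
        congr 1
        field_simp
        ring
      rw [hk]
      simp only
      rw [← mul_inv, e2, hc, norm_sub_point]
      have hsp : 0 < s ^ 2 := by positivity
      gcongr 1
      apply Real.sqrt_le_sqrt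
      gcongr ?_ + _
      rw [← sq_abs (H y - H y₀), ← sq_abs (m * (y - y₀)), abs_mul, abs_of_pos hm]
      gcongr
    have e3 : |h y| ≤ |h y₀| + C * |y - y₀| := by
      have := abs_sub_abs_le_abs_sub (h y) (h y₀)
      linarith [P.lipschitz_h y hyI y₀ hy₀I]
    have e4 : C * |y - y₀| / ‖(H y : ℂ) - c‖ ≤ C / m := by
      rw [div_le_div_iff₀ hpos hm]
      have := hex.trans (le_norm_sub_point H y y₀ (s := s))
      nlinarith
    simp only [hf]
    calc ‖(h y : ℂ) / ((H y : ℂ) - c) - (K y : ℂ)‖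
        ≤ ‖(h y : ℂ) / ((H y : ℂ) - c)‖ + ‖(K y : ℂ)‖ := norm_sub_le _ _
      _ ≤ |h y| / ‖(H y : ℂ) - c‖ + B := by
          rw [norm_div, Complex.norm_real, Complex.norm_real]
          exact add_le_add le_rfl (hB y hyI)
      _ ≤ (|h y₀| + C * |y - y₀|) / ‖(H y : ℂ) - c‖ + B := by gcongr
      _ = |h y₀| * ‖(H y : ℂ) - c‖⁻¹ + C * |y - y₀| / ‖(H y : ℂ) - c‖ + B := by
          rw [add_div, div_eq_mul_inv |h y₀|]
      _ ≤ |h y₀| * k y + C / m + B := by gcongr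
      _ = |h y₀| * k y + D := by rw [hD]; ring
  have hsub : ∀ {α β : ℝ}, a ≤ α → α ≤ β → β ≤ b → IntervalIntegrable f MeasureTheory.volume α β :=
    fun h1 h2 h3 => (hfc.mono (Icc_subset_Icc h1 h3)).intervalIntegrable_of_Icc h2
  have i1 : IntervalIntegrable f MeasureTheory.volume a (ys - τ) :=
    hsub le_rfl (by linarith) (by linarith)
  have i2 : IntervalIntegrable f MeasureTheory.volume (ys - τ) (ys + τ) :=
    hsub (by linarith) (by linarith) (by linarith)
  have i3 : IntervalIntegrable f MeasureTheory.volume (ys + τ) b :=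
    hsub (by linarith) (by linarith) le_rfl
  have b1 : ∫ y in a..(ys - τ), f y ≤ E * θ * (ys - τ - a) := by
    have := intervalIntegral.integral_mono_on (by linarith) i1
      (intervalIntegrable_const (c := E * θ)) fun y hy => hfar y ⟨hy.1, by linarith [hy.2]⟩ (by
        rw [abs_of_nonpos (by linarith [hy.2])]; linarith [hy.2])
    rw [intervalIntegral.integral_const, smul_eq_mul] at this
    linarith
  have b3 : ∫ y in (ys + τ)..b, f y ≤ E * θ * (b - (ys + τ)) := by
    have := intervalIntegral.integral_mono_on (by linarith) i3
      (intervalIntegrable_const (c := E * θ)) fun y hy => hfar y ⟨by linarith [hy.1], hy.2⟩ (by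
        rw [abs_of_nonneg (by linarith [hy.1])]; linarith [hy.1])
    rw [intervalIntegral.integral_const, smul_eq_mul] at this
    linarith
  have b2 : ∫ y in (ys - τ)..(ys + τ), f y
      ≤ |h y₀| * (2 * Real.arsinh (m * (b - a) / s) / m) + 2 * τ * D := by
    have hkc' : Continuous fun y => |h y₀| * k y := continuous_const.mul hkc
    have h1 := intervalIntegral.integral_mono_on (g := fun y => |h y₀| * k y + D)
      (by linarith) i2 ((hkc'.add continuous_const).intervalIntegrable _ _) hclose
    rw [intervalIntegral.integral_add (hkc'.intervalIntegrable _ _)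
      (continuous_const.intervalIntegrable _ _), intervalIntegral.integral_const_mul,
      intervalIntegral.integral_const, smul_eq_mul] at h1
    have h2 : ∀ y ∈ Icc a b, m * |y - y₀| ≤ m * (b - a) := by
      intro y hy
      gcongr
      rw [abs_le]
      constructor <;> linarith [hy.1, hy.2, hy₀I.1, hy₀I.2]
    have h3 := integral_inv_sqrt_le (L := m * (b - a)) hm hs (α := ys - τ) (β := ys + τ) (y₀ := y₀)
      (h2 _ ⟨by linarith, by linarith⟩) (h2 _ ⟨by linarith, by linarith⟩)
    have h4 := mul_le_mul_of_nonneg_left h3 (abs_nonneg (h y₀))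
    linarith
  have b4 : |h y₀| * (2 * Real.arsinh (m * (b - a) / s) / m) ≤ 2 * θ / m := by
    rw [mul_div_assoc', div_le_div_iff_of_pos_right hm]
    linarith
  rw [← intervalIntegral.integral_add_adjacent_intervals i1 (i2.trans i3),
    ← intervalIntegral.integral_add_adjacent_intervals i2 i3]
  have b5 : E * θ * (ys - τ - a) + E * θ * (b - (ys + τ)) ≤ E * θ * (b - a) := by
    have : 0 ≤ E * θ * τ := by positivity
    nlinarith
  linarith

theorem h_ne_zero (P : InflectionProfile a b ys δ m M C H h K) {y : ℝ} (hy : |y - ys| ≤ δ)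
    (hne : y ≠ ys) : h y ≠ 0 := by
  have hδ := P.δ_pos
  have hw := mem_window hy
  intro h0
  rcases lt_or_gt_of_ne hne with hlt | hgt
  · have := P.sign y ⟨hw.1, hlt⟩ (ys + δ) ⟨by linarith, le_rfl⟩
    simp [h0] at this
  · have := P.sign (ys - δ) ⟨le_rfl, by linarith⟩ y ⟨hgt, hw.2⟩
    simp [h0] at this

/-- If `H''(y)` and `H''(y₀)` have opposite signs, then `y` lies across `ys` from `y₀` or outside
the neighbourhood where the signs are known; in both cases `H(y)` is not too close to `H(y₀)`. -/
theorem exists_le_abs_sub_of_mul_neg (P : InflectionProfile a b ys δ m M C H h K) :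
    ∃ ρ > 0, ∀ y₀, y₀ ≠ ys → |y₀ - ys| ≤ ρ → ∀ y ∈ Icc a b, h y₀ * h y < 0 →
      m * |y₀ - ys| ≤ |H y - H y₀| := by
  have hδ := P.δ_pos
  have hm := P.m_pos
  have hM := P.M_pos
  obtain ⟨g, hg0, hg⟩ := P.exists_gap hδ
  refine ⟨min δ (g / (m + M)), by positivity, fun y₀ hne hy₀ y hy hneg => ?_⟩
  have h1 : |y₀ - ys| ≤ δ := hy₀.trans (min_le_left _ _)
  have h2 : (m + M) * |y₀ - ys| ≤ g := by
    have := hy₀.trans (min_le_right _ _)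
    rw [le_div_iff₀ (by positivity)] at this
    linarith
  have hw₀ := mem_window h1
  rcases le_or_gt δ |y - ys| with hfar | hnear
  · have h3 := hg y hy hfar
    have h4 := P.lipschitz_H y₀ (P.window_subset hw₀) ys P.ys_mem
    have h5 := abs_sub_le (H y) (H y₀) (H ys)
    linarith
  · have hw := mem_window hnear.le
    have hl : ys - δ ∈ Ico (ys - δ) ys := ⟨le_rfl, by linarith⟩
    have hr : ys + δ ∈ Ioc ys (ys + δ) := ⟨by linarith, le_rfl⟩
    have hdist : |y₀ - ys| ≤ |y - y₀| := by
      rcases lt_trichotomy y ys with hlt | heq | hgt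
      · rcases lt_or_gt_of_ne hne with hlt₀ | hgt₀
        · have e1 := P.sign y ⟨hw.1, hlt⟩ _ hr
          have e2 := P.sign y₀ ⟨hw₀.1, hlt₀⟩ _ hr
          have e3 := mul_pos_of_neg_of_neg e1 e2
          nlinarith [mul_self_nonneg (h (ys + δ))]
        · rw [abs_of_pos (by linarith), abs_of_neg (by linarith)]; linarith
      · rw [heq, abs_sub_comm]
      · rcases lt_or_gt_of_ne hne with hlt₀ | hgt₀
        · rw [abs_of_neg (by linarith), abs_of_pos (by linarith)]; linarith
        · have e1 := P.sign _ hl y ⟨hgt, hw.2⟩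
          have e2 := P.sign _ hl y₀ ⟨hgt₀, hw₀.2⟩
          have e3 := mul_pos_of_neg_of_neg e1 e2
          nlinarith [mul_self_nonneg (h (ys - δ))]
    exact (mul_le_mul_of_nonneg_left hdist hm.le).trans (P.expand y hw y₀ hw₀)

theorem im_div_sub_point (H h : ℝ → ℝ) (y y₀ s : ℝ) :
    ((h y : ℂ) / ((H y : ℂ) - point H y₀ s)).im = h y * s / ((H y - H y₀) ^ 2 + s ^ 2) := by
  rw [Complex.div_im, Complex.normSq_apply]
  simp [point]
  ring

/-- Just above `H(y₀)`, the average of the imaginary part of `H'' / (H - c)` has the sign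
of `H''(y₀)`. -/
theorem exists_mul_integral_im_pos (P : InflectionProfile a b ys δ m M C H h K) {β B : ℝ}
    (hβ : 0 < β) (hB : 0 < B) :
    ∃ ρ > 0, ∀ y₀, y₀ ≠ ys → |y₀ - ys| ≤ ρ → ∀ u : ℝ → ℝ, ContinuousOn u (Icc a b) →
      (∀ y ∈ Icc a b, 0 ≤ u y) → (∀ y ∈ Icc a b, u y ≤ B) →
      (∀ y ∈ Icc (ys - δ) (ys + δ), β ≤ u y) →
      0 < h y₀ * ∫ y in a..b,
        ((h y : ℂ) / ((H y : ℂ) - point H y₀ (h y₀ ^ 4))).im * u y := by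
  have hδ := P.δ_pos
  have hm := P.m_pos
  have hM := P.M_pos
  have hC := P.C_pos
  have hal := P.left_lt.le
  have hbr := P.lt_right.le
  have hba : 0 < b - a := by linarith
  obtain ⟨G, hG⟩ := isCompact_Icc.exists_bound_of_continuousOn P.continuousOn_h
  have hG0 : 0 ≤ G := (norm_nonneg _).trans (hG ys P.ys_mem)
  obtain ⟨ρ₁, hρ₁, hopp⟩ := P.exists_le_abs_sub_of_mul_neg
  -- the conditions on `σ = |h y₀|` used below
  obtain ⟨ξ, hξ0, hξ⟩ : ∃ ξ > 0, ∀ σ : ℝ, 0 < σ → σ ≤ ξ →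
      σ ^ 4 ≤ σ / (2 * C) ∧ σ ^ 4 ≤ δ / 2 ∧
      σ * (G * B * (b - a) * C ^ 2 / m ^ 2) < β / (M ^ 2 + 1) := by
    have t1 : Tendsto (fun σ : ℝ => σ ^ 3) (𝓝 0) (𝓝 0) := by
      simpa using (continuous_pow 3).tendsto (0 : ℝ)
    have t2 : Tendsto (fun σ : ℝ => σ ^ 4) (𝓝 0) (𝓝 0) := by
      simpa using (continuous_pow 4).tendsto (0 : ℝ)
    have t3 : Tendsto (fun σ : ℝ => σ * (G * B * (b - a) * C ^ 2 / m ^ 2)) (𝓝 0) (𝓝 0) := by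
      simpa using (continuous_mul_const (G * B * (b - a) * C ^ 2 / m ^ 2)).tendsto (0 : ℝ)
    have ev := (t1.eventually (ge_mem_nhds (show (0 : ℝ) < 1 / (2 * C) by positivity))).and
      ((t2.eventually (ge_mem_nhds (show (0 : ℝ) < δ / 2 by positivity))).and
      (t3.eventually (gt_mem_nhds (show (0 : ℝ) < β / (M ^ 2 + 1) by positivity))))
    obtain ⟨ξ, hξ0, hball⟩ := Metric.eventually_nhds_iff.1 ev
    refine ⟨ξ / 2, by positivity, fun σ hσ hσξ => ?_⟩
    obtain ⟨c1, c2, c3⟩ := hball (y := σ) (by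
      rw [Real.dist_eq, sub_zero, abs_of_pos hσ]; linarith)
    refine ⟨?_, c2, c3⟩
    calc σ ^ 4 = σ * σ ^ 3 := by ring
      _ ≤ σ * (1 / (2 * C)) := by gcongr
      _ = σ / (2 * C) := by ring
  refine ⟨min (min ρ₁ (δ / 2)) (ξ / C), by positivity, fun y₀ hne hy₀ u hu hu0 huB huβ => ?_⟩
  have hy₀1 : |y₀ - ys| ≤ ρ₁ := hy₀.trans ((min_le_left _ _).trans (min_le_left _ _))
  have hy₀2 : |y₀ - ys| ≤ δ / 2 := hy₀.trans ((min_le_left _ _).trans (min_le_right _ _))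
  have hy₀3 : C * |y₀ - ys| ≤ ξ := by
    have := hy₀.trans (min_le_right _ _)
    rw [le_div_iff₀ hC] at this
    linarith
  have hw₀ : y₀ ∈ Icc (ys - δ) (ys + δ) := mem_window (by linarith)
  have hI₀ := P.window_subset hw₀
  set σ := |h y₀| with hσ
  have hσ0 : 0 < σ := abs_pos.2 (P.h_ne_zero (by linarith) hne)
  have hσC : σ ≤ C * |y₀ - ys| := P.abs_h_le hI₀
  obtain ⟨c1, c2, c3⟩ := hξ σ hσ0 (hσC.trans hy₀3)
  set s := h y₀ ^ 4 with hs
  have hsσ : s = σ ^ 4 := by rw [hs, hσ, Even.pow_abs (by decide)]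
  have hs0 : 0 < s := by rw [hsσ]; positivity
  set t := |y₀ - ys| with ht
  have ht0 : 0 < t := abs_pos.2 (sub_ne_zero.2 hne)
  set f : ℝ → ℝ := fun y => h y₀ * (h y * s / ((H y - H y₀) ^ 2 + s ^ 2) * u y) with hf
  have hden : ∀ y, 0 < (H y - H y₀) ^ 2 + s ^ 2 := fun y => by positivity
  have hfc : ContinuousOn f (Icc a b) := by
    refine continuousOn_const.mul (ContinuousOn.mul ?_ hu)
    refine (P.continuousOn_h.mul continuousOn_const).div
      (((P.continuousOn_H.sub continuousOn_const).pow 2).add continuousOn_const)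
      fun y _ => (hden y).ne'
  have hint : h y₀ * ∫ y in a..b, ((h y : ℂ) / ((H y : ℂ) - point H y₀ s)).im * u y
      = ∫ y in a..b, f y := by
    simp only [im_div_sub_point, hf]
    rw [intervalIntegral.integral_const_mul]
  rw [hint]
  set E := σ * G * s * B / (m * t) ^ 2 with hE
  have hE0 : 0 ≤ E := by positivity
  -- the integrand is nowhere very negative
  have hlow : ∀ y ∈ Icc a b, -E ≤ f y := by
    intro y hy
    rcases le_or_gt 0 (h y₀ * h y) with hnn | hneg
    · have : 0 ≤ f y := by
        have e1 : f y = (h y₀ * h y) * (s / ((H y - H y₀) ^ 2 + s ^ 2) * u y) := by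
          simp only [hf]; ring
        rw [e1]
        exact mul_nonneg hnn (mul_nonneg (div_nonneg hs0.le (hden y).le) (hu0 y hy))
      linarith
    · have e2 := hopp y₀ hne hy₀1 y hy hneg
      have e3 : |f y| ≤ E := by
        have e4 : |f y| = σ * (|h y| * s / ((H y - H y₀) ^ 2 + s ^ 2) * u y) := by
          simp only [hf]
          rw [abs_mul, abs_mul, abs_div, abs_mul, abs_of_pos hs0, abs_of_pos (hden y),
            abs_of_nonneg (hu0 y hy)]
        have e5 : (m * t) ^ 2 ≤ (H y - H y₀) ^ 2 + s ^ 2 := by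
          rw [← sq_abs (H y - H y₀)]
          have : (m * t) ^ 2 ≤ |H y - H y₀| ^ 2 := by gcongr
          linarith [sq_nonneg s]
        have e6 : |h y| ≤ G := hG y hy
        have e7 := huB y hy
        have e8 := hu0 y hy
        rw [e4]
        calc σ * (|h y| * s / ((H y - H y₀) ^ 2 + s ^ 2) * u y)
            ≤ σ * (G * s / (m * t) ^ 2 * B) := by gcongr
          _ = E := by rw [hE]; ring
      exact (abs_le.1 e3).1
  -- it is large next to `y₀`
  set p := β * σ ^ 2 / (2 * (M ^ 2 + 1) * s) with hp
  have hnear : ∀ y ∈ Icc (y₀ - s) (y₀ + s), p ≤ f y := by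
    intro y hy
    have hys : |y - y₀| ≤ s := by rw [abs_le]; constructor <;> linarith [hy.1, hy.2]
    have hyw : y ∈ Icc (ys - δ) (ys + δ) := mem_window (by
      have := abs_sub_le y y₀ ys
      rw [← hsσ] at c2
      linarith)
    have hyI := P.window_subset hyw
    have e1 : σ ^ 2 / 2 ≤ h y₀ * h y := by
      have e2 : |h y - h y₀| ≤ σ / 2 := by
        refine (P.lipschitz_h y hyI y₀ hI₀).trans ?_
        rw [← hsσ] at c1
        rw [le_div_iff₀ (by positivity)] at c1
        linarith [mul_le_mul_of_nonneg_left hys hC.le]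
      have e3 : |h y₀ * (h y - h y₀)| ≤ σ * (σ / 2) := by
        rw [abs_mul]; gcongr
      have e4 := (abs_le.1 e3).1
      have e5 : σ ^ 2 = h y₀ * h y₀ := by rw [hσ, sq_abs, sq]
      linarith [show h y₀ * (h y - h y₀) = h y₀ * h y - h y₀ * h y₀ by ring,
        show σ * (σ / 2) = σ ^ 2 / 2 by ring]
    have e6 : (H y - H y₀) ^ 2 + s ^ 2 ≤ (M ^ 2 + 1) * s ^ 2 := by
      have e7 := P.lipschitz_H y hyI y₀ hI₀
      have e8 : |H y - H y₀| ≤ M * s := e7.trans (by gcongr)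
      rw [← sq_abs (H y - H y₀)]
      have : |H y - H y₀| ^ 2 ≤ (M * s) ^ 2 := by gcongr
      linarith [show (M * s) ^ 2 + s ^ 2 = (M ^ 2 + 1) * s ^ 2 by ring]
    have e9 := huβ y hyw
    have e10 : f y = (h y₀ * h y) * s * u y / ((H y - H y₀) ^ 2 + s ^ 2) := by
      simp only [hf]; ring
    rw [e10]
    have hd := hden y
    calc p = σ ^ 2 / 2 * s * β / ((M ^ 2 + 1) * s ^ 2) := by rw [hp]; field_simp
      _ ≤ (h y₀ * h y) * s * u y / ((H y - H y₀) ^ 2 + s ^ 2) := by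
        have : 0 ≤ h y₀ * h y := le_trans (by positivity) e1
        have := hu0 y hyI
        gcongr
  have hls : a ≤ y₀ - s ∧ y₀ + s ≤ b := by
    rw [← hsσ] at c2
    have := abs_le.1 hy₀2
    constructor <;> linarith [this.1, this.2]
  have hfE : ContinuousOn (fun y => f y + E) (Icc a b) := hfc.add continuousOn_const
  have b1 : ∫ y in (y₀ - s)..(y₀ + s), (f y + E) ≤ ∫ y in a..b, (f y + E) := by
    refine intervalIntegral.integral_mono_interval hls.1 (by linarith) hls.2 ?_
      (hfE.intervalIntegrable_of_Icc (by linarith))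
    filter_upwards [MeasureTheory.ae_restrict_mem measurableSet_Ioc] with y hy
    have := hlow y ⟨hy.1.le, hy.2⟩
    simp only [Pi.zero_apply]
    linarith
  have b2 : ∫ y in (y₀ - s)..(y₀ + s), p ≤ ∫ y in (y₀ - s)..(y₀ + s), (f y + E) := by
    refine intervalIntegral.integral_mono_on (by linarith) intervalIntegrable_const
      ((hfE.mono (Icc_subset_Icc hls.1 hls.2)).intervalIntegrable_of_Icc (by linarith))
      fun y hy => ?_
    have := hnear y hy
    linarith
  rw [intervalIntegral.integral_add (hfc.intervalIntegrable_of_Icc (by linarith))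
    intervalIntegrable_const, intervalIntegral.integral_const, smul_eq_mul] at b1
  rw [intervalIntegral.integral_const, smul_eq_mul] at b2
  have b3 : (y₀ + s - (y₀ - s)) * p = β / (M ^ 2 + 1) * σ ^ 2 := by
    rw [hp]; field_simp; ring
  have b4 : (b - a) * E ≤ σ * (G * B * (b - a) * C ^ 2 / m ^ 2) * σ ^ 2 := by
    have e1 : σ ^ 2 ≤ C ^ 2 * t ^ 2 := by
      rw [← mul_pow]; gcongr
    calc (b - a) * E = σ * G * B * (b - a) / m ^ 2 * σ ^ 2 * (σ ^ 2 / t ^ 2) := by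
          rw [hE, hsσ]; field_simp
      _ ≤ σ * G * B * (b - a) / m ^ 2 * σ ^ 2 * C ^ 2 := by
          gcongr
          rw [div_le_iff₀ (by positivity)]
          exact e1
      _ = _ := by ring
  have b5 : σ * (G * B * (b - a) * C ^ 2 / m ^ 2) * σ ^ 2 < β / (M ^ 2 + 1) * σ ^ 2 :=
    mul_lt_mul_of_pos_right c3 (by positivity)
  linarith

end InflectionProfile

theorem exists_mul_arsinh_le {L ε : ℝ} (hL : 0 < L) (hε : 0 < ε) :
    ∃ ξ > 0, ∀ x, 0 < x → x ≤ ξ → x * Real.arsinh (L / x ^ 4) ≤ ε := by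
  have hcont : ContinuousAt (fun x : ℝ => x * Real.log (x ^ 4 + (x ^ 4 + L + L)) -
      4 * (x * Real.log x)) 0 := by
    refine ContinuousAt.sub (continuousAt_id.mul (ContinuousAt.log (by fun_prop) ?_))
      (continuousAt_const.mul Real.continuous_mul_log.continuousAt)
    simp only [ne_eq, OfNat.ofNat_ne_zero, not_false_eq_true, zero_pow, zero_add]
    positivity
  have hε' : (0 : ℝ) * Real.log (0 ^ 4 + (0 ^ 4 + L + L)) - 4 * (0 * Real.log 0) < ε := by
    simpa using hε
  have h0 := hcont.tendsto.eventually (ge_mem_nhds hε')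
  obtain ⟨ξ, hξ, hball⟩ := Metric.eventually_nhds_iff.1 h0
  refine ⟨ξ / 2, by positivity, fun x hx hxξ => ?_⟩
  have h1 := hball (y := x) (by rw [Real.dist_eq, sub_zero, abs_of_pos hx]; linarith)
  refine le_trans ?_ h1
  have hz : 0 < L / x ^ 4 := by positivity
  have h2 : Real.arsinh (L / x ^ 4) ≤ Real.log (x ^ 4 + (x ^ 4 + L + L)) - 4 * Real.log x := by
    have e1 : Real.log (x ^ 4 + (x ^ 4 + L + L)) - 4 * Real.log x
        = Real.log ((x ^ 4 + (x ^ 4 + L + L)) / x ^ 4) := by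
      rw [Real.log_div (by positivity) (by positivity), Real.log_pow]
      norm_num
    rw [e1, Real.arsinh]
    refine Real.log_le_log (by positivity) ?_
    have e2 : √(1 + (L / x ^ 4) ^ 2) ≤ 1 + L / x ^ 4 := by
      rw [Real.sqrt_le_left (by positivity)]
      nlinarith
    have e3 : (x ^ 4 + (x ^ 4 + L + L)) / x ^ 4 = 2 + 2 * (L / x ^ 4) := by
      field_simp; ring
    rw [e3]
    linarith
  have h3 := mul_le_mul_of_nonneg_left h2 hx.le
  linarith

end CriticalLayer

/-! ### The inflection point of a monotone profile -/

section Profile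

open Filter Topology

theorem exists_lipschitz_of_contDiffOn_one {a b : ℝ} (hab : a < b) {f : ℝ → ℝ}
    (hf : ContDiffOn ℝ 1 f (Icc a b)) :
    ∃ C > 0, ∀ y ∈ Icc a b, ∀ z ∈ Icc a b, |f y - f z| ≤ C * |y - z| := by
  obtain ⟨C, hC⟩ := isCompact_Icc.exists_bound_of_continuousOn
    (hf.continuousOn_derivWithin (uniqueDiffOn_Icc hab) le_rfl)
  refine ⟨max C 1, by positivity, fun y hy z hz => ?_⟩
  refine ((convex_Icc a b).norm_image_sub_le_of_norm_derivWithin_le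
    (hf.differentiableOn one_ne_zero) hC hz hy).trans ?_
  exact mul_le_mul_of_nonneg_right (le_max_left _ _) (norm_nonneg _)

theorem exists_inflectionProfile {a b ys : ℝ} {H : ℝ → ℝ} (hH : ContDiffOn ℝ 3 H (Icc a b))
    (hH' : ∀ y ∈ Ioo a b, deriv H y ≠ 0) (hys : ys ∈ Ioo a b) (hys2 : deriv (deriv H) ys = 0)
    (hsign : ChangesSignAt (deriv (deriv H)) ys) :
    ∃ δ m M C : ℝ, ∃ h K : ℝ → ℝ, InflectionProfile a b ys δ m M C H h K ∧
      (∀ y ∈ Ioo a b, h y = deriv (deriv H) y) ∧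
      ∀ y ∈ Ioo a b, K y = tollmienPotential H ys y := by
  have hab : a < b := hys.1.trans hys.2
  have hU := uniqueDiffOn_Icc hab
  set d := derivWithin H (Icc a b) with hd
  have hdc : ContDiffOn ℝ 2 d (Icc a b) := hH.derivWithin hU (by norm_num)
  set h := derivWithin d (Icc a b) with hh
  have hhc : ContDiffOn ℝ 1 h (Icc a b) := hdc.derivWithin hU (by norm_num)
  have hdd : ∀ y ∈ Ioo a b, d y = deriv H y := fun y hy =>
    derivWithin_of_mem_nhds (Icc_mem_nhds hy.1 hy.2)
  have hhh : ∀ y ∈ Ioo a b, h y = deriv (deriv H) y := by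
    intro y hy
    have h1 : deriv H =ᶠ[𝓝 y] d := by
      filter_upwards [Ioo_mem_nhds hy.1 hy.2] with z hz using (hdd z hz).symm
    rw [h1.deriv_eq]
    exact derivWithin_of_mem_nhds (Icc_mem_nhds hy.1 hy.2)
  have hHd : ∀ y ∈ Ioo a b, DifferentiableAt ℝ H y := fun y hy =>
    differentiableAt_of_deriv_ne_zero (hH' y hy)
  have hinj : InjOn H (Icc a b) := by
    have key : ∀ y ∈ Icc a b, ∀ z ∈ Icc a b, y < z → H y ≠ H z := by
      intro y hy z hz hyz heq
      obtain ⟨x, hx, hx0⟩ := exists_deriv_eq_zero hyz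
        (hH.continuousOn.mono (Icc_subset_Icc hy.1 hz.2)) heq
      exact hH' x ⟨hy.1.trans_lt hx.1, hx.2.trans_le hz.2⟩ hx0
    intro y hy z hz heq
    by_contra hne
    rcases lt_or_gt_of_ne hne with hlt | hgt
    · exact key y hy z hz hlt heq
    · exact key z hz y hy hgt heq.symm
  obtain ⟨M, hM0, hM⟩ := exists_lipschitz_of_contDiffOn_one hab (hH.of_le (by norm_num))
  obtain ⟨C, hC0, hC⟩ := exists_lipschitz_of_contDiffOn_one hab hhc
  obtain ⟨δ₁, hδ₁, hs⟩ := hsign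
  set m := |deriv H ys| / 2 with hm
  have hm0 : 0 < m := half_pos (abs_pos.2 (hH' ys hys))
  have hcontd : ContinuousAt (fun y => |deriv H y|) ys := by
    have h1 : ContinuousAt d ys := hdc.continuousOn.continuousAt (Icc_mem_nhds hys.1 hys.2)
    have h2 : deriv H =ᶠ[𝓝 ys] d := by
      filter_upwards [Ioo_mem_nhds hys.1 hys.2] with z hz using (hdd z hz).symm
    exact (h1.congr h2.symm).abs
  have hev : ∀ᶠ y in 𝓝 ys, m < |deriv H y| ∧ y ∈ Ioo a b ∧ y ∈ Ioo (ys - δ₁) (ys + δ₁) :=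
    (hcontd.eventually (lt_mem_nhds (by rw [hm]; linarith))).and
      (Eventually.and (Ioo_mem_nhds hys.1 hys.2) (Ioo_mem_nhds (by linarith) (by linarith)))
  obtain ⟨ε, hε, hball⟩ := Metric.eventually_nhds_iff.1 hev
  have hwin : ∀ y ∈ Icc (ys - ε / 2) (ys + ε / 2),
      m < |deriv H y| ∧ y ∈ Ioo a b ∧ y ∈ Ioo (ys - δ₁) (ys + δ₁) := by
    intro y hy
    refine hball ?_
    rw [Real.dist_eq, abs_lt]
    constructor <;> linarith [hy.1, hy.2]
  have hl := hwin (ys - ε / 2) ⟨le_rfl, by linarith⟩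
  have hr := hwin (ys + ε / 2) ⟨by linarith, le_rfl⟩
  have hdiff2 : DifferentiableAt ℝ (deriv (deriv H)) ys := by
    have h1 : DifferentiableAt ℝ h ys :=
      (hhc.differentiableOn one_ne_zero).differentiableAt (Icc_mem_nhds hys.1 hys.2)
    refine h1.congr_of_eventuallyEq ?_
    filter_upwards [Ioo_mem_nhds hys.1 hys.2] with z hz using (hhh z hz).symm
  have hpot := continuousAt_tollmienPotential (hH' ys hys) hys2 hdiff2
  set K : ℝ → ℝ := fun y => if y = ys then deriv (deriv (deriv H)) ys / deriv H ys
    else h y / (H y - H ys) with hK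
  have hKpot : ∀ y ∈ Ioo a b, K y = tollmienPotential H ys y := by
    intro y hy
    simp only [hK, tollmienPotential, hhh y hy]
  have hHne : ∀ y ∈ Icc a b, y ≠ ys → H y - H ys ≠ 0 := fun y hy hne =>
    sub_ne_zero.2 fun heq => hne (hinj hy (Ioo_subset_Icc_self hys) heq)
  have hhys : h ys = 0 := (hhh ys hys).trans hys2
  refine ⟨ε / 2, m, M, C, h, K, ⟨by positivity, hm0, hM0, hC0, hl.2.1.1, hr.2.1.2,
    hH.continuousOn, hhc.continuousOn, ?_, hinj, hM, hC, ?_, ?_, hhys, ?_⟩, hhh, hKpot⟩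
  · intro y hy
    rcases eq_or_ne y ys with rfl | hne
    · refine (hpot.congr ?_).continuousWithinAt
      filter_upwards [Ioo_mem_nhds hys.1 hys.2] with z hz using (hKpot z hz).symm
    · have h1 : ContinuousWithinAt (fun y => h y / (H y - H ys)) (Icc a b) y :=
        (hhc.continuousOn y hy).div ((hH.continuousOn y hy).sub continuousWithinAt_const)
          (hHne y hy hne)
      have h2 : K =ᶠ[𝓝 y] fun y => h y / (H y - H ys) := by
        filter_upwards [isOpen_ne.mem_nhds hne] with z hz
        exact if_neg hz
      exact h1.congr_of_eventuallyEq (h2.filter_mono nhdsWithin_le_nhds) h2.self_of_nhds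
  · have key : ∀ y ∈ Icc (ys - ε / 2) (ys + ε / 2), ∀ z ∈ Icc (ys - ε / 2) (ys + ε / 2), y < z →
        m * |y - z| ≤ |H y - H z| := by
      intro y hy z hz hyz
      obtain ⟨x, hx, hx'⟩ := exists_deriv_eq_slope H hyz
        (hH.continuousOn.mono (Icc_subset_Icc (hwin y hy).2.1.1.le (hwin z hz).2.1.2.le))
        (fun x hx => (hHd x ⟨(hwin y hy).2.1.1.trans hx.1,
          hx.2.trans (hwin z hz).2.1.2⟩).differentiableWithinAt)
      have h1 := (hwin x ⟨hy.1.trans hx.1.le, hx.2.le.trans hz.2⟩).1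
      have h2 : 0 < z - y := by linarith
      rw [eq_div_iff h2.ne'] at hx'
      rw [abs_sub_comm y z, abs_sub_comm (H y), ← hx', abs_mul]
      gcongr
    intro y hy z hz
    rcases lt_trichotomy y z with hlt | heq | hgt
    · exact key y hy z hz hlt
    · simp [heq]
    · rw [abs_sub_comm y, abs_sub_comm (H y)]
      exact key z hz y hy hgt
  · intro y hy
    rcases eq_or_ne y ys with rfl | hne
    · rw [hhys, sub_self, mul_zero]
    · simp only [hK, if_neg hne]
      exact div_mul_cancel₀ _ (hHne y hy hne)
  · intro y hy z hz
    have h1 := hwin y ⟨hy.1, by linarith [hy.2]⟩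
    have h2 := hwin z ⟨by linarith [hz.1], hz.2⟩
    rw [hhh y h1.2.1, hhh z h2.2.1]
    exact hs y ⟨h1.2.2.1, hy.2⟩ z ⟨hz.1, h2.2.2.2⟩

end Profile

/-! ### The path across the critical layer -/

section Path

variable {a b ys δ m M C : ℝ} {H h K : ℝ → ℝ}

namespace InflectionProfile

/-- A path in the upper half-plane above the two points `ys ± t`, low at its ends: it consists of
the points `H(y₀) + i t` with `|y₀ - ys| ≤ t`, and of the vertical segments from its two ends down
to height `H''(ys ± t)⁴`. -/
theorem exists_isPreconnected_path (P : InflectionProfile a b ys δ m M C H h K) {θ ρ L : ℝ}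
    (hθ : 0 < θ) (hρ : 0 < ρ) (hL : 0 < L) :
    ∃ t > 0, t ≤ ρ ∧ t ≤ δ ∧ ∃ Γ : Set ℂ, IsPreconnected Γ ∧
      (∀ c ∈ Γ, ∃ y₀ s, c = point H y₀ s ∧ |y₀ - ys| ≤ θ ∧ 0 < s ∧ s ≤ θ ∧
        |h y₀| * Real.arsinh (L / s) ≤ θ) ∧
      point H (ys + t) (h (ys + t) ^ 4) ∈ Γ ∧ point H (ys - t) (h (ys - t) ^ 4) ∈ Γ := by
  have hδ := P.δ_pos
  have hC := P.C_pos
  obtain ⟨ξ, hξ, hars⟩ := exists_mul_arsinh_le hL (lt_min hθ (div_pos hθ hC))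
  set t := min (min (min ρ δ) (min θ 1)) (min (min ξ (ξ / C)) (1 / C ^ 4)) with ht
  have ht0 : 0 < t := by positivity
  have l1 : t ≤ min ρ δ := (min_le_left _ _).trans (min_le_left _ _)
  have l2 : t ≤ min θ 1 := (min_le_left _ _).trans (min_le_right _ _)
  have l3 : t ≤ min ξ (ξ / C) := (min_le_right _ _).trans (min_le_left _ _)
  have tρ : t ≤ ρ := l1.trans (min_le_left _ _)
  have tδ : t ≤ δ := l1.trans (min_le_right _ _)
  have tθ : t ≤ θ := l2.trans (min_le_left _ _)
  have t1 : t ≤ 1 := l2.trans (min_le_right _ _)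
  have tξ : t ≤ ξ := l3.trans (min_le_left _ _)
  have tξC : C * t ≤ ξ := by
    have := l3.trans (min_le_right _ _)
    rw [le_div_iff₀ hC] at this
    linarith
  have tC : C ^ 4 * t ≤ 1 := by
    have : t ≤ 1 / C ^ 4 := (min_le_right _ _).trans (min_le_right _ _)
    rw [le_div_iff₀ (by positivity)] at this
    linarith
  clear_value t
  have hbound : ∀ y₀, |y₀ - ys| ≤ t → |h y₀| ≤ C * t := fun y₀ hy₀ =>
    (P.abs_h_le (P.window_subset (mem_window (hy₀.trans tδ)))).trans (by gcongr)
  have harsinh_nonneg : ∀ x : ℝ, 0 ≤ x → 0 ≤ Real.arsinh x := fun x hx =>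
    Real.arsinh_nonneg_iff.2 hx
  have hhor : ∀ y₀, |y₀ - ys| ≤ t → |h y₀| * Real.arsinh (L / t) ≤ θ := by
    intro y₀ hy₀
    have e1 : Real.arsinh (L / t) ≤ Real.arsinh (L / t ^ 4) := by
      rw [Real.arsinh_le_arsinh]
      gcongr
      exact pow_le_of_le_one ht0.le t1 (by norm_num)
    have e2 := (hars t ht0 tξ).trans (min_le_right _ _)
    rw [le_div_iff₀ hC] at e2
    have e3 := harsinh_nonneg (L / t) (by positivity)
    calc |h y₀| * Real.arsinh (L / t) ≤ C * t * Real.arsinh (L / t ^ 4) :=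
          mul_le_mul (hbound y₀ hy₀) e1 e3 (by positivity)
      _ ≤ θ := by linarith
  have hvert : ∀ y₀, |y₀ - ys| = t → 0 < h y₀ ^ 4 ∧ h y₀ ^ 4 ≤ t ∧
      ∀ s, h y₀ ^ 4 ≤ s → |h y₀| * Real.arsinh (L / s) ≤ θ := by
    intro y₀ hy₀
    have hne : h y₀ ≠ 0 := P.h_ne_zero (hy₀.le.trans tδ) (by
      rintro rfl
      rw [sub_self, abs_zero] at hy₀
      exact ht0.ne hy₀)
    have hpos : 0 < |h y₀| := abs_pos.2 hne
    have hb := hbound y₀ hy₀.le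
    have e0 : h y₀ ^ 4 = |h y₀| ^ 4 := (Even.pow_abs (by decide) _).symm
    have e1 : 0 < h y₀ ^ 4 := by rw [e0]; positivity
    refine ⟨e1, ?_, fun s hs => ?_⟩
    · rw [e0]
      calc |h y₀| ^ 4 ≤ (C * t) ^ 4 := by gcongr
        _ = C ^ 4 * t * t ^ 3 := by ring
        _ ≤ 1 * t ^ 3 := by gcongr
        _ ≤ t := by rw [one_mul]; exact pow_le_of_le_one ht0.le t1 (by norm_num)
    · have e2 := (hars |h y₀| hpos (hb.trans tξC)).trans (min_le_left _ _)
      refine le_trans ?_ e2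
      gcongr
      rwa [← e0]
  have hp : |ys + t - ys| = t := by rw [add_sub_cancel_left, abs_of_pos ht0]
  have hq : |ys - t - ys| = t := by rw [sub_sub_cancel_left, abs_neg, abs_of_pos ht0]
  set Γ₀ := (fun y => point H y t) '' Icc (ys - t) (ys + t) with hΓ₀
  set Γ₁ := (fun s => point H (ys + t) s) '' Icc (h (ys + t) ^ 4) t with hΓ₁
  set Γ₂ := (fun s => point H (ys - t) s) '' Icc (h (ys - t) ^ 4) t with hΓ₂
  have c0 : IsPreconnected Γ₀ := by
    refine isPreconnected_Icc.image _ ?_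
    have hsub : Icc (ys - t) (ys + t) ⊆ Icc a b :=
      (Icc_subset_Icc (by linarith) (by linarith)).trans P.window_subset
    have e1 : (fun y => point H y t) = fun y => (H y : ℂ) + (t : ℂ) * Complex.I := by
      funext y
      apply Complex.ext <;> simp [point]
    rw [e1]
    exact (Complex.continuous_ofReal.comp_continuousOn (P.continuousOn_H.mono hsub)).add
      continuousOn_const
  have cv : ∀ (y : ℝ) (r : ℝ), IsPreconnected ((fun s => point H y s) '' Icc r t) := by
    intro y r
    refine isPreconnected_Icc.image _ (Continuous.continuousOn ?_)
    have e1 : (fun s => point H y s) = fun s : ℝ => (H y : ℂ) + (s : ℂ) * Complex.I := by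
      funext s
      apply Complex.ext <;> simp [point]
    rw [e1]
    fun_prop
  have mp0 : point H (ys + t) t ∈ Γ₀ := ⟨ys + t, ⟨by linarith, le_rfl⟩, rfl⟩
  have mq0 : point H (ys - t) t ∈ Γ₀ := ⟨ys - t, ⟨le_rfl, by linarith⟩, rfl⟩
  have mp1 : point H (ys + t) t ∈ Γ₁ := ⟨t, ⟨(hvert _ hp).2.1, le_rfl⟩, rfl⟩
  have mq2 : point H (ys - t) t ∈ Γ₂ := ⟨t, ⟨(hvert _ hq).2.1, le_rfl⟩, rfl⟩
  refine ⟨t, ht0, tρ, tδ, Γ₀ ∪ Γ₁ ∪ Γ₂, ?_, ?_, ?_, ?_⟩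
  · exact (c0.union _ mp0 mp1 (cv _ _)).union _ (Or.inl mq0) mq2 (cv _ _)
  · rintro c ((⟨y, hy, rfl⟩ | ⟨s, hs, rfl⟩) | ⟨s, hs, rfl⟩)
    · have hy' : |y - ys| ≤ t := by rw [abs_le]; constructor <;> linarith [hy.1, hy.2]
      exact ⟨y, t, rfl, hy'.trans tθ, ht0, tθ, hhor y hy'⟩
    · obtain ⟨v1, v2, v3⟩ := hvert _ hp
      exact ⟨ys + t, s, rfl, hp.le.trans tθ, v1.trans_le hs.1, hs.2.trans tθ, v3 s hs.1⟩
    · obtain ⟨v1, v2, v3⟩ := hvert _ hq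
      exact ⟨ys - t, s, rfl, hq.le.trans tθ, v1.trans_le hs.1, hs.2.trans tθ, v3 s hs.1⟩
  · exact Or.inl (Or.inr ⟨_, ⟨le_rfl, (hvert _ hp).2.1⟩, rfl⟩)
  · exact Or.inr ⟨_, ⟨le_rfl, (hvert _ hq).2.1⟩, rfl⟩

end InflectionProfile

end Path

/-! ### Unstable modes -/

section Unstable

variable {a b ys δ m M C : ℝ} {H h K : ℝ → ℝ}

theorem differentiableAt_comp_mul_inverse_sub {R : Type*} [NormedCommRing R] [NormedAlgebra ℂ R]
    [CompleteSpace R] (J : R →L[ℂ] R) (f g : R) {c : ℂ} (hu : IsUnit (g - algebraMap ℂ R c)) :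
    DifferentiableAt ℂ (fun c => J.comp (ContinuousLinearMap.mul ℂ R
      (f * Ring.inverse (g - algebraMap ℂ R c)))) c := by
  have h1 : DifferentiableAt ℂ (fun c => g - algebraMap ℂ R c) c :=
    (differentiableAt_const g).sub (Algebra.linearMap ℂ R).toContinuousLinearMap.differentiableAt
  have h2 : DifferentiableAt ℂ (fun c => Ring.inverse (g - algebraMap ℂ R c)) c :=
    DifferentiableAt.comp c (g := Ring.inverse) (differentiableAt_inverse hu) h1
  have h3 : DifferentiableAt ℂ (fun c => f * Ring.inverse (g - algebraMap ℂ R c)) c :=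
    (differentiableAt_const f).mul h2
  have h4 : DifferentiableAt ℂ (fun c => ContinuousLinearMap.mul ℂ R
      (f * Ring.inverse (g - algebraMap ℂ R c))) c :=
    (ContinuousLinearMap.mul ℂ R).differentiableAt.comp c h3
  exact (differentiableAt_const J).clm_comp h4

theorem continuousAt_norm_sub {E : Type*} [NormedAddCommGroup E] [NormedSpace ℂ E]
    {f : ℂ → E →L[ℂ] E} {c : ℂ} (hf : ContinuousAt f c) (A : E →L[ℂ] E) :
    ContinuousAt (fun c => ‖f c - A‖) c :=
  (hf.sub continuousAt_const).norm

/-- Complexification of a real function which is continuous on `[a, b]`. -/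
noncomputable def complexMap {f : ℝ → ℝ} (hf : ContinuousOn f (Icc a b)) : C(Icc a b, ℂ) :=
  ⟨fun y => (f y : ℂ), Complex.continuous_ofReal.comp hf.domRestrict⟩

/-- The Rayleigh potential `h / (H - c)` as a continuous function on `[a, b]`. -/
noncomputable def rayleighPotential (hh : ContinuousOn h (Icc a b)) (hH : ContinuousOn H (Icc a b))
    (c : ℂ) : C(Icc a b, ℂ) :=
  complexMap hh * Ring.inverse (complexMap hH - algebraMap ℂ _ c)

theorem isUnit_complexMap_sub (hH : ContinuousOn H (Icc a b)) {c : ℂ} (hc : 0 < c.im) :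
    IsUnit (complexMap hH - algebraMap ℂ _ c) := by
  rw [ContinuousMap.isUnit_iff_forall_ne_zero]
  intro y h0
  have := congrArg Complex.im h0
  simp [complexMap] at this
  exact hc.ne' this

theorem rayleighPotential_apply (hh : ContinuousOn h (Icc a b)) (hH : ContinuousOn H (Icc a b))
    {c : ℂ} (hc : 0 < c.im) (y : Icc a b) :
    rayleighPotential hh hH c y = (h y : ℂ) / ((H y : ℂ) - c) := by
  have hu := isUnit_complexMap_sub hH hc
  have h1 : ((H y : ℂ) - c) * Ring.inverse (complexMap hH - algebraMap ℂ _ c) y = 1 :=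
    congrArg (fun f : C(Icc a b, ℂ) => f y) (Ring.mul_inverse_cancel _ hu)
  have h2 : (H y : ℂ) - c ≠ 0 := left_ne_zero_of_mul_eq_one h1
  rw [eq_div_iff h2]
  have h3 : rayleighPotential hh hH c y
      = (h y : ℂ) * Ring.inverse (complexMap hH - algebraMap ℂ _ c) y := rfl
  rw [h3, mul_assoc, mul_comm _ ((H y : ℂ) - c), h1, mul_one]

/-- If the operator with the limiting potential `K` has a negative eigenvalue, then the Rayleigh
equation has unstable modes for all `α` in some interval, with `c` depending continuously
on `α`. -/
theorem InflectionProfile.exists_unstable_curve (P : InflectionProfile a b ys δ m M C H h K)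
    {lam : ℝ} (hlam : lam < 0) {q : C(Icc a b, ℝ)} (hq : ∀ y : Icc a b, q y = K y)
    (hab : a < b)
    (hz : ∃ y : Icc a b, a < y ∧ shoot (volterra hab.le (q - algebraMap ℝ _ lam)) y = 0) :
    ∃ α₁ α₂ : ℝ, 0 ≤ α₁ ∧ α₁ < α₂ ∧ ∃ c : ℝ → ℂ, ContinuousOn c (Ioo α₁ α₂) ∧
      ∀ α ∈ Ioo α₁ α₂, 0 < (c α).im ∧ ∃ v : ℝ → ℂ, IsNonzeroDirichlet a b v ∧
        ∀ y ∈ Ioo a b, deriv (deriv v) y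
          = ((h y : ℂ) / ((H y : ℂ) - c α) + (α : ℂ) ^ 2) * v y := by
  have hle := hab.le
  have hδ := P.δ_pos
  -- the positive eigenfunction `φ` of the limiting operator
  obtain ⟨lam₁, hlam₁, hφb, hφpos⟩ := exists_lowest_eigenvalue hab q hz
  set φ := shoot (volterra hle (q - algebraMap ℝ _ lam₁)) with hφ
  have hneg : lam₁ < 0 := hlam₁.trans_lt hlam
  set Q : C(Icc a b, ℂ) := complexMap P.continuousOn_K with hQ
  set Φ := shoot (volterra hle (Q - algebraMap ℂ _ (lam₁ : ℂ))) with hΦ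
  have hΦφ : ∀ y, Φ y = (φ y : ℂ) := shoot_volterra_ofReal hle _ _ fun y => by
    simp [hQ, complexMap, hq]
  set J := doubleIntegral ℂ hle with hJ
  set e := ramp ℂ a b with he
  set ℓ : C(Icc a b, ℂ) →L[ℂ] ℂ := ContinuousMap.evalCLM ℂ ⟨b, hle, le_rfl⟩ with hℓ
  have hℓa : ∀ f, ℓ f = f ⟨b, hle, le_rfl⟩ := fun f => rfl
  have hA₀ : volterra hle Q - (lam₁ : ℂ) • J = volterra hle (Q - algebraMap ℂ _ (lam₁ : ℂ)) :=
    volterra_sub_const hle Q _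
  have hΦ' : Ring.inverse (1 - (volterra hle Q - (lam₁ : ℂ) • J)) e = Φ := by rw [hA₀]; rfl
  have hU : IsUnit (1 - (volterra hle Q - (lam₁ : ℂ) • J)) := by
    rw [hA₀]; exact isUnit_one_sub_volterra _ _
  have hΦb : Φ ⟨b, hle, le_rfl⟩ = 0 := by rw [hΦφ, hφb]; simp
  have hsimple : ℓ (Ring.inverse (1 - (volterra hle Q - (lam₁ : ℂ) • J)) (J Φ)) ≠ 0 := by
    intro h0
    rw [hA₀] at h0
    have h1 := integral_sq_eq_zero_of_inverse_apply hle _ hΦb h0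
    have h2 : ∀ y, (IccExtend hle Φ y) ^ 2 = ((IccExtend hle φ y ^ 2 : ℝ) : ℂ) := fun y => by
      have : IccExtend hle Φ y = ((IccExtend hle φ y : ℝ) : ℂ) := hΦφ _
      rw [this]
      push_cast
      rfl
    simp only [← hΦ, h2] at h1
    rw [intervalIntegral.integral_ofReal] at h1
    have h3 : 0 < ∫ y in a..b, IccExtend hle φ y ^ 2 := by
      refine intervalIntegral.intervalIntegral_pos_of_pos_on
        (((continuous_extend_Icc hle φ).pow 2).intervalIntegrable _ _) (fun y hy => ?_) hab
      rw [IccExtend_of_mem _ _ (Ioo_subset_Icc_self hy)]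
      exact pow_pos (hφpos ⟨y, _⟩ hy) 2
    exact h3.ne' (by exact_mod_cast h1)
  -- a lower bound for `φ` near `ys`
  obtain ⟨β, hβ, hφβ⟩ : ∃ β > 0, ∀ y : Icc a b, (y : ℝ) ∈ Icc (ys - δ) (ys + δ) → 2 * β ≤ φ y := by
    obtain ⟨y₁, hy₁, hmin⟩ := (isCompact_Icc (a := ys - δ) (b := ys + δ)).exists_isMinOn
      ⟨ys, by linarith, by linarith⟩ (continuous_extend_Icc hle φ).continuousOn
    have hy₁I : y₁ ∈ Ioo a b := ⟨P.left_lt.trans_le hy₁.1, hy₁.2.trans_lt P.lt_right⟩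
    have hpos := hφpos ⟨y₁, Ioo_subset_Icc_self hy₁I⟩ hy₁I
    refine ⟨φ ⟨y₁, Ioo_subset_Icc_self hy₁I⟩ / 2, by positivity, fun y hy => ?_⟩
    have : IccExtend hle φ y₁ ≤ IccExtend hle φ y := hmin hy
    rw [IccExtend_val, IccExtend_of_mem _ _ (Ioo_subset_Icc_self hy₁I)] at this
    linarith
  -- the eigenvalue and the eigenfunction continue to nearby potentials
  obtain ⟨η, hη, ν, hν⟩ := exists_eigenvalue_branch (volterra hle Q) J lam₁ e ℓ hU
    (by rw [hΦ', hℓa, hΦb]) (by rw [hΦ']; exact hsimple) (lt_min hβ (neg_pos.2 hneg))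
  rw [hΦ'] at hν
  set R : ℂ → C(Icc a b, ℂ) := rayleighPotential P.continuousOn_h P.continuousOn_H with hR
  set N : ℂ → ℂ := fun c => ν (volterra hle (R c)) with hN
  set S : Set ℂ := {c | 0 < c.im} ∩ {c | ‖volterra hle (R c) - volterra hle Q‖ < η} with hS
  have hVd : ∀ c : ℂ, 0 < c.im → DifferentiableAt ℂ (fun c => volterra hle (R c)) c := fun c hc =>
    differentiableAt_comp_mul_inverse_sub (R := C(Icc a b, ℂ)) J _ _
      (isUnit_complexMap_sub P.continuousOn_H hc)
  have hSo : IsOpen S := by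
    have h1 : IsOpen {c : ℂ | 0 < c.im} := isOpen_lt continuous_const Complex.continuous_im
    have h2 : ContinuousOn (fun c => ‖volterra hle (R c) - volterra hle Q‖) {c : ℂ | 0 < c.im} :=
      fun c hc => (continuousAt_norm_sub (hVd c hc).continuousAt _).continuousWithinAt
    exact h2.isOpen_inter_preimage h1 isOpen_Iio
  have hNd : DifferentiableOn ℂ N S := fun c hc =>
    ((hν _ hc.2).1.comp c (hVd c hc.1)).differentiableWithinAt
  have hNre : ∀ c ∈ S, (N c).re < 0 := by
    intro c hc
    have h1 := ((hν _ hc.2).2.1).trans_le (min_le_right _ _)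
    have h2 := (Complex.abs_re_le_norm (N c - lam₁)).trans_lt h1
    rw [Complex.sub_re, Complex.ofReal_re] at h2
    linarith [(abs_lt.1 h2).2]
  have hsol : ∀ c ∈ S, shoot (volterra hle (R c - algebraMap ℂ _ (N c))) ⟨b, hle, le_rfl⟩ = 0 ∧
      ‖shoot (volterra hle (R c - algebraMap ℂ _ (N c))) - Φ‖ < β := by
    intro c hc
    obtain ⟨-, -, h3, h4⟩ := hν _ hc.2
    have h5 : Ring.inverse (1 - (volterra hle (R c) - N c • J)) e
        = shoot (volterra hle (R c - algebraMap ℂ _ (N c))) := by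
      rw [← volterra_sub_const]; rfl
    rw [h5] at h3 h4
    exact ⟨h4, h3.trans_le (min_le_left _ _)⟩
  -- the path across the critical layer
  obtain ⟨θ, hθ, hL1⟩ := P.exists_integral_norm_sub_le
    (η := η / (2 * (b - a))) (div_pos hη (by linarith))
  obtain ⟨ρ, hρ, hsign⟩ := P.exists_mul_integral_im_pos (β := β ^ 2) (B := (‖Φ‖ + β) ^ 2)
    (by positivity) (by positivity)
  obtain ⟨t, ht, htρ, htδ, Γ, hΓ, hΓc, hΓp, hΓq⟩ := P.exists_isPreconnected_path hθ hρ
    (L := m * (b - a)) (mul_pos P.m_pos (by linarith))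
  have hΓS : Γ ⊆ S := by
    intro c hc
    obtain ⟨y₀, s, rfl, h1, h2, h3, h4⟩ := hΓc c hc
    refine ⟨h2, ?_⟩
    have h5 := hL1 y₀ s h1 h2 h3 h4
    have h6 := norm_volterra_le hle (R (point H y₀ s) - Q)
    rw [volterra_sub] at h6
    have h7 : ∫ y in a..b, ‖IccExtend hle ⇑(R (point H y₀ s) - Q) y‖
        = ∫ y in a..b, ‖(h y : ℂ) / ((H y : ℂ) - point H y₀ s) - (K y : ℂ)‖ := by
      refine intervalIntegral.integral_congr fun y hy => ?_
      rw [uIcc_of_le hle] at hy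
      simp only [IccExtend_of_mem _ _ hy, ContinuousMap.sub_apply, hR]
      rw [rayleighPotential_apply (c := point H y₀ s) _ _ h2 ⟨y, hy⟩]
      rfl
    rw [h7] at h6
    have h8 := mul_le_mul_of_nonneg_left h5 (show 0 ≤ b - a by linarith)
    have h9 : (b - a) * (η / (2 * (b - a))) = η / 2 := by
      have : b - a ≠ 0 := by linarith
      field_simp
    exact (h6.trans (h8.trans h9.le)).trans_lt (half_lt_self hη)
  -- the sign of the imaginary part of the eigenvalue at the two ends of the path
  have hend : ∀ y₀, |y₀ - ys| = t → point H y₀ (h y₀ ^ 4) ∈ Γ →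
      0 < h y₀ * (N (point H y₀ (h y₀ ^ 4))).im := by
    intro y₀ hy₀ hmem
    have hcS := hΓS hmem
    set c := point H y₀ (h y₀ ^ 4) with hc
    obtain ⟨hvb, hvΦ⟩ := hsol c hcS
    set v := shoot (volterra hle (R c - algebraMap ℂ _ (N c))) with hv
    have hne : y₀ ≠ ys := by
      rintro rfl
      rw [sub_self, abs_zero] at hy₀
      exact ht.ne hy₀
    have hvnear : ∀ y, ‖v y - Φ y‖ ≤ β := fun y => ((v - Φ).norm_coe_le_norm y).trans hvΦ.le
    have h1 := hsign y₀ hne (hy₀.le.trans htρ) (fun y => ‖IccExtend hle v y‖ ^ 2)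
      ((continuous_extend_Icc hle v).norm.pow 2).continuousOn (fun y _ => by positivity)
      (fun y _ => by
        have e1 : ‖IccExtend hle v y‖ ≤ ‖Φ‖ + β := by
          refine (norm_extend_Icc_le hle v y).trans ?_
          have := norm_add_le Φ (v - Φ)
          rw [add_sub_cancel] at this
          linarith
        gcongr)
      (fun y hy => by
        have hyI := P.window_subset hy
        have e1 : β ≤ ‖IccExtend hle v y‖ := by
          rw [IccExtend_of_mem _ _ hyI]
          have e2 := hvnear ⟨y, hyI⟩
          have e3 := hφβ ⟨y, hyI⟩ hy
          have e4 : φ ⟨y, hyI⟩ ≤ ‖Φ ⟨y, hyI⟩‖ := by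
            rw [hΦφ, Complex.norm_real]; exact le_abs_self _
          have e5 := norm_sub_norm_le (Φ ⟨y, hyI⟩) (v ⟨y, hyI⟩)
          rw [norm_sub_rev] at e5
          linarith
        gcongr)
    have h2 := im_eigenvalue_mul_integral hle (R c) (N c) hvb
    have h3 : ∫ y in a..b, (IccExtend hle (R c) y).im * ‖IccExtend hle v y‖ ^ 2
        = ∫ y in a..b, ((h y : ℂ) / ((H y : ℂ) - c)).im * ‖IccExtend hle v y‖ ^ 2 := by
      refine intervalIntegral.integral_congr fun y hy => ?_
      rw [uIcc_of_le hle] at hy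
      rw [IccExtend_of_mem _ (R c) hy, hR, rayleighPotential_apply _ _ hcS.1]
    rw [← hv, h3] at h2
    rw [← h2, ← mul_assoc] at h1
    exact pos_of_mul_pos_left h1
      (intervalIntegral.integral_nonneg hle fun y _ => by positivity)
  have hp := hend (ys + t) (by rw [add_sub_cancel_left, abs_of_pos ht]) hΓp
  have hq' := hend (ys - t) (by rw [sub_sub_cancel_left, abs_neg, abs_of_pos ht]) hΓq
  have hpq := P.sign (ys - t) ⟨by linarith, by linarith⟩ (ys + t) ⟨by linarith, by linarith⟩
  have himneg : (N (point H (ys + t) (h (ys + t) ^ 4))).im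
      * (N (point H (ys - t) (h (ys - t) ^ 4))).im < 0 := by
    have h1 := mul_pos hp hq'
    by_contra hcon
    nlinarith
  obtain ⟨α₁, α₂, hα₁, hα₁₂, c, hc, hcα⟩ :=
    exists_continuousOn_eq_neg_sq hSo hNd hNre hΓS hΓ hΓp hΓq himneg
  refine ⟨α₁, α₂, hα₁, hα₁₂, c, hc, fun α hα => ?_⟩
  obtain ⟨hcS, hcN⟩ := hcα α hα
  obtain ⟨v, hv, hv'⟩ := exists_isNonzeroDirichlet_of_shoot_eq_zero hab _ (hsol (c α) hcS).1
  refine ⟨hcS.1, v, hv, fun y hy => ?_⟩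
  rw [hv' y hy, IccExtend_of_mem _ _ (Ioo_subset_Icc_self hy), ContinuousMap.sub_apply, hcN, hR,
    rayleighPotential_apply _ _ hcS.1]
  simp

end Unstable

theorem theorem3p1 (a b κ : ℝ) (U W H : ℝ → ℝ)
    (hU : ContDiffOn ℝ 3 U (Icc a b)) (hW : ContDiffOn ℝ 3 W (Icc a b))
    (hH : H = fun y => U y + κ * W y)
    (hH' : ∀ y ∈ Ioo a b, deriv H y ≠ 0)
    (yStar : ℝ) (hyStar : yStar ∈ Ioo a b)
    (hH'' : deriv (deriv H) yStar = 0)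
    (hsign : ChangesSignAt (deriv (deriv H)) yStar)
    (hneg : ∃ lam : ℝ, lam < 0 ∧ IsSturmLiouvilleEigenvalue a b H yStar lam) :
    (∃ (α : ℝ) (c : ℂ), 0 < α ∧ IsUnstableRayleighEigenvalue a b H α c) ∧
    (∃ α₁ α₂ : ℝ, 0 ≤ α₁ ∧ α₁ < α₂ ∧ ∃ c : ℝ → ℂ, ContinuousOn c (Ioo α₁ α₂) ∧
      ∀ α ∈ Ioo α₁ α₂, IsUnstableRayleighEigenvalue a b H α (c α)) := by
  have hab : a < b := hyStar.1.trans hyStar.2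
  have hHC : ContDiffOn ℝ 3 H (Icc a b) := hH ▸ hU.add (contDiffOn_const.mul hW)
  obtain ⟨δ, m, M, C, h, K, P, hh, hK⟩ :=
    exists_inflectionProfile hHC hH' hyStar hH'' hsign
  obtain ⟨lam, hlam, v, hv, hveq⟩ := hneg
  let q : C(Icc a b, ℝ) := ⟨(Icc a b).domRestrict K, P.continuousOn_K.domRestrict⟩
  have hz : ∃ y : Icc a b, a < y ∧ shoot (volterra hab.le (q - algebraMap ℝ _ lam)) y = 0 := by
    refine exists_shoot_eq_zero_of_isNonzeroDirichlet hab _ hv fun y hy => ?_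
    have h1 := hveq y hy
    rw [← hK y hy] at h1
    rw [IccExtend_of_mem _ _ (Ioo_subset_Icc_self hy)]
    have h2 : (q - algebraMap ℝ C(Icc a b, ℝ) lam) ⟨y, Ioo_subset_Icc_self hy⟩ = K y - lam := by
      simp [q]
    rw [h2]
    linarith
  obtain ⟨α₁, α₂, hα₁, hα₁₂, c, hc, hcα⟩ :=
    P.exists_unstable_curve hlam (q := q) (fun _ => rfl) hab hz
  have hunst : ∀ α ∈ Ioo α₁ α₂, IsUnstableRayleighEigenvalue a b H α (c α) := by
    intro α hα
    obtain ⟨hcim, w, hw, hweq⟩ := hcα α hα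
    refine ⟨hcim, w, hw, fun y hy => ?_⟩
    rw [hweq y hy, hh y hy]
    ring
  obtain ⟨α, hα⟩ := nonempty_Ioo.2 hα₁₂
  exact ⟨⟨α, c α, hα₁.trans_lt hα.1, hunst α hα⟩, α₁, α₂, hα₁, hα₁₂, c, hc, hunst⟩
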